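/- Fix $q\in\mathbb C$ with $0<|q|<1$ and a square root $q^{1/2}$ of $q$. Write $x=\cos\theta=\tfrac12(z+z^{-1})$ with $z=e^{i\theta}\in\mathbb C\setminus\{0\}$, and regard a function $f$ of $x$ as the function $\breve f(z)=f\big(\tfrac12(z+z^{-1})\big)$ of $z$. The Askey–Wilson operator $\mathcal D_q$ is $$(\mathcal D_q g)(z)=\frac{g(q^{1/2}z)-g(q^{-1/2}z)}{(q^{1/2}-q^{-1/2})(z-z^{-1})/2},$$ applied to functions $f$ of $x$ through $g=\breve f$. Let $(\alpha;q)_\infty=\prod_{n\ge0}(1-\alpha q^n)$, $(\alpha,\beta;q)_\infty=(\alpha;q)_\infty(\beta;q)_\infty$, and for $a,b,c,d\in\mathbb C$ let $$\omega=\omega(x;a,b,c,d\,|\,q)=\frac{(e^{2i\theta},e^{-2i\theta};q)_\infty}{(ae^{i\theta},ae^{-i\theta};q)_\infty(be^{i\theta},be^{-i\theta};q)_\infty(ce^{i\theta},ce^{-i\theta};q)_\infty(de^{i\theta},de^{-i\theta};q)_\infty\,\sin\theta}$$ be the Askey–Wilson weight, a meromorphic function of $z\in\mathbb C\setminus\{0\}$,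 and $\tilde\omega=\omega(x;aq^{1/2},bq^{1/2},cq^{1/2},dq^{1/2}\,|\,q)$ the shifted weight. For an entire function $f$ with Nevanlinna characteristic $T(r,f)$ put $$\sigma_{\log}(f)=\limsup_{r\to\infty}\frac{\log T(r,f)}{\log\log r}\in[-\infty,\infty]\qquad(\log 0=-\infty).$$ The difference equations below are identities between meromorphic functions of $z\in\mathbb C\setminus\{0\}$. (i) Let $A$ be an entire function with $1<\sigma_{\log}(A)<\infty$. If $f\not\equiv0$ is an entire solution of $$\mathcal D_q\big[\tilde\omega\,\mathcal D_q f\big]+\omega\,A\,f=0,$$ then $\sigma_{\log}(f)\ge\sigma_{\log}(A)+1$. (ii) Let $k\ge1$ and let $A_0,\dots,A_{k-1}$ be entire functions with $\sigma_{\log}(A_0)>\sigma_{\log}(A_j)\ge1$ for $j=1,\dots,k-1$. If $f\not\equiv0$ is an entire solution of $$\mathcal D_q^{k}f+A_{k-1}\,\mathcal D_q^{k-1}f+\cdots+A_1\,\mathcal D_q f+A_0\,f=0,$$ then $\sigma_{\log}(f)\ge\sigma_{\log}(A_0)+1$. -/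

import Mathlib

open Filter Topology

noncomputable section

/-- The logarithmic order `limsup_{r → ∞} log T(r, f) / log log r`, where `T(r, f)` is the Nevanlinna
characteristic (with respect to the poles of `f`). It takes values in `[-∞, ∞]`, with the
convention `log 0 = -∞`, so that it also makes sense for bounded or rapidly growing `f`. -/
def logOrder (f : ℂ → ℂ) : EReal :=
  limsup (fun r : ℝ =>
    ENNReal.log (ENNReal.ofReal (ValueDistribution.characteristic f ⊤ r)) /
      ((Real.log (Real.log r) : ℝ) : EReal)) atTop

/-- A function `f` of `x = (z + 1/z)/2` regarded as a function of `z`. -/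
def breve (f : ℂ → ℂ) (z : ℂ) : ℂ := f ((z + z⁻¹) / 2)

/-- The Askey-Wilson divided difference operator, acting on functions of `z = e^{iθ}`, where
`x = cos θ = (z + 1/z)/2`. Here `s` is the chosen square root of `q`. Functions of `x` are acted
upon through `breve`. -/
def awD (s : ℂ) (g : ℂ → ℂ) (z : ℂ) : ℂ :=
  (g (s * z) - g (s⁻¹ * z)) / (breve id (s * z) - breve id (s⁻¹ * z))

/-- The infinite `q`-shifted factorial `(a; q)_∞`. -/
def qPochInf (a q : ℂ) : ℂ := ∏' k : ℕ, (1 - a * q ^ k)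

/-- The product `(a e^{iθ}, a e^{-iθ}; q)_∞` as a function of `z = e^{iθ}`. -/
def qPair (q a z : ℂ) : ℂ := qPochInf (a * z) q * qPochInf (a * z⁻¹) q

/-- The Askey-Wilson weight `ω(x; a, b, c, d | q)` with `x = cos θ`, as a function of
`z = e^{iθ}`; thus `sin θ = (z - 1/z)/(2i)`. -/
def awWeight (q a b c d z : ℂ) : ℂ :=
  (qPochInf (z ^ 2) q * qPochInf ((z ^ 2)⁻¹) q) /
    (qPair q a z * qPair q b z * qPair q c z * qPair q d z *
      ((z - z⁻¹) / (2 * Complex.I)))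

/-- Equality of functions on the punctured plane off a set without accumulation points in the
punctured plane: for meromorphic functions, equality as meromorphic functions. -/
def EqMero (g h : ℂ → ℂ) : Prop := g =ᶠ[codiscreteWithin ({0}ᶜ : Set ℂ)] h

/-- `D_q[ω̃ D_q f] + ω A f = 0`, with `ω̃ (x) = ω (x; a s, b s, c s, d s | q)`, `s² = q`. -/
def SolvesAW (q s a b c d : ℂ) (A f : ℂ → ℂ) : Prop :=
  EqMero
    (fun z => awD s (fun w => awWeight q (a * s) (b * s) (c * s) (d * s) w *
        awD s (breve f) w) z +
      awWeight q a b c d z * breve A z * breve f z)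
    (fun _ => 0)

/-- `D_q^k f + A_{k-1} D_q^{k-1} f + ⋯ + A_1 D_q f + A_0 f = 0`. -/
def SolvesAWOrder (s : ℂ) (k : ℕ) (A : ℕ → ℂ → ℂ) (f : ℂ → ℂ) : Prop :=
  EqMero
    (fun z => (awD s)^[k] (breve f) z +
      ∑ j ∈ Finset.range k, breve (A j) z * (awD s)^[j] (breve f) z)
    (fun _ => 0)

end

/-! Suppose `logOrder f` is less than the order of the coefficient plus one. Then log max |f| over
|x| ≤ r is at most (log r)^τ for some τ > 1 with τ - 1 still below the order of the coefficient.

The core is a comparison on circles, `LogGrowth.exists_circle`. Comparing the circles of radius r²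
and r⁴ shows that f has n = O((log r)^(τ-1)) zeros in |x| ≤ r². Write f as the product of these root
factors and a cofactor h. Since h has no zeros up to radius r², far beyond Kr, Borel-Carathéodory
makes the oscillation of log |h| on |x| ≤ Kr bounded. On some circle with radius in [r, 2r] that
stays r/(4(n+1)) away from the zeros, the root factors lose at most a factor (C(n+1))^n = exp(O(n
log n)). So on that circle |f| dominates its values on |x| ≤ Kr up to exp((log r)^τ'), for any τ' >
τ - 1.

The equation expresses A f at z through values of f at points q^(j/2) z of comparable modulus. For
the weighted equation this uses that ω̃(q^(±1/2) z)/ω(z) is rational in z, of size |z|²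
(`awWeight_shift`). Dividing by f on the good circles and applying the maximum principle, A grows no
faster than exp((log r)^σ') with σ' below its own order, a contradiction.

If A₀ has order at most 1 in (ii), domination forces k = 1. The factor 1/|z| gained by `awD` then
gives A₀ = 0, whose order is `⊥`.

Passing from the Nevanlinna characteristic to the maximum modulus is a Poisson-Jensen estimate
(`norm_le_exp_characteristic`). -/

open Metric Set Asymptotics

/-! ### Root factors and zeros of entire functions in disks -/

/-- `∏ (x - a)`, the product over a multiset of points `a`. -/
def rootProd (S : Multiset ℂ) (x : ℂ) : ℂ := (S.map fun a => x - a).prod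

lemma rootProd_cons (a : ℂ) (S : Multiset ℂ) (x : ℂ) :
    rootProd (a ::ₘ S) x = (x - a) * rootProd S x := by
  simp [rootProd]

lemma rootProd_eq_zero_iff {S : Multiset ℂ} {x : ℂ} : rootProd S x = 0 ↔ x ∈ S := by
  simp [rootProd, Multiset.prod_eq_zero_iff, sub_eq_zero]

lemma pow_card_le_norm_rootProd {S : Multiset ℂ} {x : ℂ} {c : ℝ} (hc : 0 ≤ c)
    (h : ∀ a ∈ S, c ≤ ‖x - a‖) : c ^ S.card ≤ ‖rootProd S x‖ := by
  induction S using Multiset.induction with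
  | empty => simp [rootProd]
  | cons a S ih =>
    rw [rootProd_cons, norm_mul, Multiset.card_cons, pow_succ']
    exact mul_le_mul (h a (by simp)) (ih fun b hb => h b (by simp [hb])) (by positivity)
      (by positivity)

lemma norm_rootProd_le_mul {S : Multiset ℂ} {x y : ℂ} {c : ℝ} (hc : 0 ≤ c)
    (h : ∀ a ∈ S, ‖x - a‖ ≤ c * ‖y - a‖) : ‖rootProd S x‖ ≤ c ^ S.card * ‖rootProd S y‖ := by
  induction S using Multiset.induction with
  | empty => simp [rootProd]
  | cons a S ih =>
    rw [rootProd_cons, rootProd_cons, norm_mul, norm_mul, Multiset.card_cons]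
    calc ‖x - a‖ * ‖rootProd S x‖ ≤ (c * ‖y - a‖) * (c ^ S.card * ‖rootProd S y‖) :=
          mul_le_mul (h a (by simp)) (ih fun b hb => h b (by simp [hb])) (by positivity)
            (by positivity)
      _ = _ := by ring

lemma norm_rootProd_le {S : Multiset ℂ} {x : ℂ} {c : ℝ} (hc : 0 ≤ c)
    (h : ∀ a ∈ S, ‖x - a‖ ≤ c) : ‖rootProd S x‖ ≤ c ^ S.card := by
  induction S using Multiset.induction with
  | empty => simp [rootProd]
  | cons a S ih =>
    rw [rootProd_cons, norm_mul, Multiset.card_cons, pow_succ']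
    exact mul_le_mul (h a (by simp)) (ih fun b hb => h b (by simp [hb])) (by positivity)
      (by positivity)

/-- Maximum modulus principle on disks around the origin. -/
lemma norm_le_of_sphere {f : ℂ → ℂ} (hf : Differentiable ℂ f) {r M : ℝ} (hr : 0 < r)
    (h : ∀ x, ‖x‖ = r → ‖f x‖ ≤ M) {x : ℂ} (hx : ‖x‖ ≤ r) : ‖f x‖ ≤ M := by
  refine Complex.norm_le_of_forall_mem_frontier_norm_le (U := ball 0 r) isBounded_ball
    hf.diffContOnCl (fun z hz => ?_) ?_
  · rw [frontier_ball _ hr.ne'] at hz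
    exact h z (by simpa using hz)
  · rw [closure_ball _ hr.ne']
    simpa using hx

/-- Bound for the cofactor of a product of root factors. -/
lemma norm_cofactor_le {f h : ℂ → ℂ} {S : Multiset ℂ} {R ρ M : ℝ} (hh : Differentiable ℂ h)
    (hS : ∀ a ∈ S, ‖a‖ ≤ R) (hfh : ∀ x, f x = rootProd S x * h x) (hR : 0 ≤ R) (hρ : R < ρ)
    (hM : ∀ x, ‖x‖ = ρ → ‖f x‖ ≤ M) {x : ℂ} (hx : ‖x‖ ≤ ρ) :
    ‖h x‖ * (ρ - R) ^ S.card ≤ M := by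
  have hpos : 0 < (ρ - R) ^ S.card := pow_pos (by linarith) _
  rw [← le_div_iff₀ hpos]
  refine norm_le_of_sphere hh (by linarith) (fun y hy => ?_) hx
  rw [le_div_iff₀ hpos]
  calc ‖h y‖ * (ρ - R) ^ S.card ≤ ‖h y‖ * ‖rootProd S y‖ := by
        gcongr
        refine pow_card_le_norm_rootProd (by linarith) fun a ha => ?_
        have := norm_sub_norm_le y a
        have := hS a ha
        linarith
    _ = ‖f y‖ := by rw [hfh, norm_mul, mul_comm]
    _ ≤ M := hM y hy

/-- Zero counting: the number of zeros in a disk is bounded by the growth of the function. -/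
lemma card_roots_bound {f h : ℂ → ℂ} {S : Multiset ℂ} {R M : ℝ} {x₀ : ℂ}
    (hh : Differentiable ℂ h) (hS : ∀ a ∈ S, ‖a‖ ≤ R) (hfh : ∀ x, f x = rootProd S x * h x)
    (hR : 3 ≤ R) (hx₀ : ‖x₀‖ ≤ 1) (hM : ∀ x, ‖x‖ = R ^ 2 → ‖f x‖ ≤ M) :
    (R / 2) ^ S.card * ‖f x₀‖ ≤ M := by
  have h1 : ‖h x₀‖ * (R ^ 2 - R) ^ S.card ≤ M :=
    norm_cofactor_le hh hS hfh (by linarith) (by nlinarith) hM (by nlinarith)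
  have h2 : ‖rootProd S x₀‖ ≤ (R + 1) ^ S.card :=
    norm_rootProd_le (by linarith) fun a ha => by
      have := norm_sub_le x₀ a
      have := hS a ha
      linarith
  refine le_trans ?_ h1
  rw [hfh, norm_mul]
  calc (R / 2) ^ S.card * (‖rootProd S x₀‖ * ‖h x₀‖)
      ≤ (R / 2) ^ S.card * ((R + 1) ^ S.card * ‖h x₀‖) := by gcongr
    _ = ‖h x₀‖ * (R / 2 * (R + 1)) ^ S.card := by rw [mul_pow]; ring
    -- R/2 · (R + 1) ≤ R² - R amounts to R ≥ 3.
    _ ≤ ‖h x₀‖ * (R ^ 2 - R) ^ S.card := by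
        gcongr
        nlinarith

/-- An entire function that does not vanish identically is the product of finitely many root
factors and an entire function without zeros in a given closed disk. -/
lemma exists_rootProd_mul {f : ℂ → ℂ} (hf : Differentiable ℂ f) {x₀ : ℂ} (hx₀ : ‖x₀‖ ≤ 1)
    (hfx₀ : f x₀ ≠ 0) {R : ℝ} (hR : 3 ≤ R) :
    ∃ (S : Multiset ℂ) (h : ℂ → ℂ), (∀ a ∈ S, ‖a‖ ≤ R) ∧ Differentiable ℂ h ∧
      (∀ x, f x = rootProd S x * h x) ∧ ∀ x, ‖x‖ ≤ R → h x ≠ 0 := by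
  -- P n says that n root factors can be split off. Zero counting bounds such n, so a largest one
  -- exists; a zero of its cofactor in the disk would allow one more factor, through `dslope`.
  let P : ℕ → Prop := fun n => ∃ (S : Multiset ℂ) (h : ℂ → ℂ), S.card = n ∧
    (∀ a ∈ S, ‖a‖ ≤ R) ∧ Differentiable ℂ h ∧ (∀ x, f x = rootProd S x * h x)
  have hP0 : P 0 := ⟨0, f, by simp, by simp, hf, by simp [rootProd]⟩
  obtain ⟨M, hM⟩ : ∃ M, ∀ x, ‖x‖ = R ^ 2 → ‖f x‖ ≤ M := by
    obtain ⟨M, hM⟩ := (isCompact_sphere (0 : ℂ) (R ^ 2)).exists_bound_of_continuousOn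
      hf.continuous.continuousOn
    exact ⟨M, fun x hx => hM x (by simpa using hx)⟩
  obtain ⟨N, hN⟩ : ∃ N : ℕ, ∀ n, P n → n < N := by
    obtain ⟨N, hN⟩ := pow_unbounded_of_one_lt (M / ‖f x₀‖) (show 1 < R / 2 by linarith)
    refine ⟨N, fun n ⟨S, h, hc, hS, hh, hfh⟩ => ?_⟩
    have := card_roots_bound hh hS hfh hR hx₀ hM
    rw [← le_div_iff₀ (by simpa using hfx₀), hc] at this
    exact (pow_lt_pow_iff_right₀ (show 1 < R / 2 by linarith)).1 (this.trans_lt hN)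
  classical
  have hspec := Nat.findGreatest_spec (P := P) (Nat.zero_le N) hP0
  obtain ⟨S, h, hc, hS, hh, hfh⟩ := hspec
  refine ⟨S, h, hS, hh, hfh, fun a ha h0 => ?_⟩
  have hP : P (Nat.findGreatest P N + 1) := by
    refine ⟨a ::ₘ S, dslope h a, by simp [hc], ?_, ?_, fun x => ?_⟩
    · intro b hb
      rcases Multiset.mem_cons.1 hb with rfl | hb
      · exact ha
      · exact hS b hb
    · rw [← differentiableOn_univ] at hh ⊢
      exact (Complex.differentiableOn_dslope univ_mem).2 hh
    · have := sub_smul_dslope h a x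
      rw [h0, sub_zero, smul_eq_mul] at this
      rw [rootProd_cons, hfh, ← this]
      ring
  have := Nat.le_findGreatest (hN _ hP).le hP
  omega

/-! ### Circles away from the zeros -/

/-- Among the circles of radius in `[r, 2 r]` one keeps its distance from `n` given points. -/
lemma exists_radius_gap (S : Multiset ℂ) {r : ℝ} (hr : 0 < r) :
    ∃ t, r ≤ t ∧ t ≤ 2 * r ∧ ∀ a ∈ S, r / (4 * (S.card + 1)) ≤ |t - ‖a‖| := by
  set n := S.card with hn
  set δ : ℝ := r / (4 * (n + 1)) with hδ
  have hδ0 : 0 < δ := by positivity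
  have hδn : δ * (4 * (n + 1)) = r := by rw [hδ]; field_simp
  by_contra! hcon
  -- Pigeonhole: the n + 1 radii r + 2iδ, i ≤ n, lie in [r, 2r] and are 2δ apart, so each ‖a‖ is
  -- within δ of at most one of them.
  have key : ∀ i ∈ Finset.range (n + 1), ∃ a ∈ S, |r + i * (2 * δ) - ‖a‖| < δ := by
    intro i hi
    have hi' : (i : ℝ) ≤ n := by exact_mod_cast Nat.lt_succ_iff.1 (Finset.mem_range.1 hi)
    refine hcon _ (by nlinarith [show (0 : ℝ) ≤ i * (2 * δ) by positivity]) ?_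
    nlinarith [mul_le_mul_of_nonneg_right hi' hδ0.le]
  choose! g hgS hg using key
  have hcard : (Finset.range (n + 1)).card ≤ S.toFinset.card := by
    refine Finset.card_le_card_of_injOn g (fun i hi => by simpa using hgS i hi) ?_
    intro i hi j hj hij
    have h1 := abs_lt.1 (hg i hi)
    have h2 := abs_lt.1 (hg j hj)
    simp only [hij] at h1
    have h3 : ((i : ℝ) - j) * (2 * δ) < 1 * (2 * δ) := by linarith
    have h4 : ((j : ℝ) - i) * (2 * δ) < 1 * (2 * δ) := by linarith
    have h5 := lt_of_mul_lt_mul_right h3 (by positivity)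
    have h6 := lt_of_mul_lt_mul_right h4 (by positivity)
    have h7 : i < j + 1 := by exact_mod_cast (by linarith : (i : ℝ) < j + 1)
    have h8 : j < i + 1 := by exact_mod_cast (by linarith : (j : ℝ) < i + 1)
    omega
  have := S.toFinset_card_le
  simp at hcard
  omega

/-- Oscillation bound for `log ‖h‖`, for a function `h` without zeros in a large disk. -/
lemma log_norm_sub_le_of_zero_free {h : ℂ → ℂ} (hh : Differentiable ℂ h) {R M ρ : ℝ} {x₀ : ℂ}
    (hx₀ : ‖x₀‖ ≤ 1) (hR : ∀ x, ‖x‖ ≤ R → h x ≠ 0) (hM : 0 < M)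
    (hb : ∀ x, ‖x‖ ≤ R → Real.log ‖h x‖ - Real.log ‖h x₀‖ ≤ M) (hρ : ρ + 2 < R)
    {x y : ℂ} (hx : ‖x‖ ≤ ρ) (hy : ‖y‖ ≤ ρ) :
    Real.log ‖h x‖ - Real.log ‖h y‖ ≤ 4 * M * (ρ + 1) / (R - 2 - ρ) := by
  have hρ0 : 0 ≤ ρ := (norm_nonneg x).trans hx
  have hsub : ∀ u ∈ ball x₀ (R - 1), ‖u‖ ≤ R := fun u hu => by
    rw [mem_ball, dist_eq_norm] at hu
    have := norm_le_norm_sub_add u x₀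
    linarith
  have hharm : InnerProductSpace.HarmonicOnNhd (fun u => Real.log ‖h u‖) (ball x₀ (R - 1)) :=
    fun u hu => (hh.analyticAt u).harmonicAt_log_norm (hR u (hsub u hu))
  obtain ⟨F, hF, hFre⟩ := hharm.exists_analyticOnNhd_ball_re_eq
  have hx₀mem : x₀ ∈ ball x₀ (R - 1) := mem_ball_self (by linarith)
  have hshift : ∀ u : ℂ, u ∈ ball (0 : ℂ) (R - 1) → x₀ + u ∈ ball x₀ (R - 1) := fun u hu => by
    simpa using hu
  -- On the ball of radius R - 1 about x₀, log ‖h‖ is the real part of an analytic F, and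
  -- Borel-Carathéodory turns the one-sided bound M into a two-sided one. As ‖u - x₀‖ ≤ ρ + 1, the
  -- denominator is (R - 1) - (ρ + 1).
  have key : ∀ u : ℂ, ‖u‖ ≤ ρ →
      |Real.log ‖h u‖ - Real.log ‖h x₀‖| ≤ 2 * M * (ρ + 1) / (R - 2 - ρ) := by
    intro u hu
    have hv : ‖u - x₀‖ ≤ ρ + 1 := (norm_sub_le _ _).trans (by linarith)
    have hvmem : u - x₀ ∈ ball (0 : ℂ) (R - 1) := by
      rw [mem_ball_zero_iff]
      linarith
    have hu' : u ∈ ball x₀ (R - 1) := by simpa using hshift _ hvmem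
    have hbc := Complex.borelCaratheodory_zero (f := fun v => F (x₀ + v) - F x₀) (R := R - 1)
      (z := u - x₀) hM
      (((hF.differentiableOn).comp (by fun_prop) hshift).sub_const _)
      (fun v hv => by
        have e1 := hFre (hshift v hv)
        have e2 := hFre hx₀mem
        simp only at e1 e2
        change (F (x₀ + v) - F x₀).re ≤ M
        rw [Complex.sub_re, e1, e2]
        exact hb _ (hsub _ (hshift v hv)))
      (by linarith) hvmem (by simp)
    rw [add_sub_cancel] at hbc
    have e1 := hFre hu'
    have e2 := hFre hx₀mem
    simp only at e1 e2
    rw [← e1, ← e2, ← Complex.sub_re]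
    refine (Complex.abs_re_le_norm _).trans (hbc.trans ?_)
    apply div_le_div₀ (by positivity) (by gcongr) (by linarith) (by linarith)
  have h1 := abs_le.1 (key x hx)
  have h2 := abs_le.1 (key y hy)
  have : 4 * M * (ρ + 1) / (R - 2 - ρ) = 2 * (2 * M * (ρ + 1) / (R - 2 - ρ)) := by ring
  linarith

/-- Comparison of the values of an entire function on a circle keeping its distance from the
zeros with its values on a disk of comparable radius. -/
lemma norm_le_mul_on_circle {f h : ℂ → ℂ} {S : Multiset ℂ} {R M K r t : ℝ} {x₀ : ℂ}
    (hh : Differentiable ℂ h) (hfh : ∀ x, f x = rootProd S x * h x)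
    (hx₀ : ‖x₀‖ ≤ 1) (hR : ∀ x, ‖x‖ ≤ R → h x ≠ 0) (hM : 0 < M)
    (hb : ∀ x, ‖x‖ ≤ R → Real.log ‖h x‖ - Real.log ‖h x₀‖ ≤ M) (hr : 0 < r) (hK : 2 ≤ K)
    (hKR : K * r + 2 < R) (ht2 : t ≤ 2 * r)
    (hgap : ∀ a ∈ S, r / (4 * (S.card + 1)) ≤ |t - ‖a‖|)
    {x y : ℂ} (hx : ‖x‖ ≤ K * r) (hy : ‖y‖ = t) :
    f y ≠ 0 ∧ ‖f x‖ ≤ (1 + 4 * (K + 2) * (S.card + 1)) ^ S.card *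
      Real.exp (4 * M * (K * r + 1) / (R - 2 - K * r)) * ‖f y‖ := by
  have hyK : ‖y‖ ≤ K * r := by rw [hy]; nlinarith
  have hδ : 0 < r / (4 * ((S.card : ℝ) + 1)) := by positivity
  have hdist : ∀ a ∈ S, r / (4 * (S.card + 1)) ≤ ‖y - a‖ := fun a ha =>
    (hgap a ha).trans (by rw [← hy]; exact abs_norm_sub_norm_le y a)
  have hx0 : h x ≠ 0 := hR x (by linarith)
  have hy0 : h y ≠ 0 := hR y (by linarith)
  constructor
  · rw [hfh]
    refine mul_ne_zero (fun h0 => ?_) hy0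
    have := hdist y (rootProd_eq_zero_iff.1 h0)
    simp at this
    linarith
  -- Here ‖x - y‖ ≤ (K + 2) r, which is 4(K + 2)(n + 1) times the gap, and the gap is at most ‖y -
  -- a‖.
  · have h1 : ‖rootProd S x‖ ≤ (1 + 4 * (K + 2) * (S.card + 1)) ^ S.card * ‖rootProd S y‖ := by
      refine norm_rootProd_le_mul (by positivity) fun a ha => ?_
      have e1 : ‖x - a‖ ≤ ‖x - y‖ + ‖y - a‖ := norm_sub_le_norm_sub_add_norm_sub x y a
      have e2 : ‖x - y‖ ≤ K * r + 2 * r := (norm_sub_le _ _).trans (by linarith)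
      have e3 := mul_le_mul_of_nonneg_left (hdist a ha)
        (show 0 ≤ 4 * (K + 2) * ((S.card : ℝ) + 1) by positivity)
      have e4 : 4 * (K + 2) * ((S.card : ℝ) + 1) * (r / (4 * (S.card + 1))) = K * r + 2 * r := by
        field_simp
      linarith
    have h2 := log_norm_sub_le_of_zero_free hh hx₀ hR hM hb hKR hx hyK
    rw [← Real.log_div (by simpa) (by simpa), Real.log_le_iff_le_exp (by positivity),
      div_le_iff₀ (by positivity)] at h2
    rw [hfh, hfh, norm_mul, norm_mul]
    calc ‖rootProd S x‖ * ‖h x‖ ≤ _ * _ := mul_le_mul h1 h2 (by positivity) (by positivity)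
      _ = _ := by ring

/-! ### Logarithmic growth and comparison on circles -/

/-- The growth condition `log max_{‖x‖ ≤ r} ‖f x‖ ≤ (log r) ^ τ` for all large `r`. -/
def LogGrowth (f : ℂ → ℂ) (τ : ℝ) : Prop :=
  ∀ᶠ r : ℝ in atTop, ∀ x, ‖x‖ ≤ r → ‖f x‖ ≤ Real.exp (Real.log r ^ τ)

lemma exists_ne_zero_norm_le_one {f : ℂ → ℂ} (hf : Differentiable ℂ f) (hf0 : f ≠ 0) :
    ∃ x₀, ‖x₀‖ ≤ 1 ∧ f x₀ ≠ 0 := by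
  by_contra! hcon
  refine hf0 (AnalyticOnNhd.eq_of_eventuallyEq (𝕜 := ℂ) (fun x _ => hf.analyticAt x)
    (fun x _ => analyticAt_const) (z₀ := 0) ?_)
  filter_upwards [closedBall_mem_nhds (0 : ℂ) one_pos] with x hx
  exact hcon x (by simpa using hx)

lemma eventually_mul_rpow_add_le_exp (a c τ : ℝ) {b : ℝ} (hb : 0 ≤ b) :
    ∀ᶠ L : ℝ in atTop, a * ((b * L) ^ τ + c) ≤ Real.exp L := by
  have h1 : (fun L : ℝ => a * b ^ τ * L ^ τ + a * c) =o[atTop] Real.exp :=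
    ((isLittleO_rpow_exp_atTop τ).const_mul_left _).add
      ((isLittleO_const_left.2 (Or.inr (tendsto_norm_atTop_atTop.comp Real.tendsto_exp_atTop))))
  filter_upwards [h1.bound one_pos, eventually_ge_atTop 0] with L hL hL0
  rw [Real.mul_rpow hb hL0]
  rw [one_mul, Real.norm_eq_abs, Real.norm_eq_abs, Real.abs_exp] at hL
  have := (le_abs_self _).trans hL
  linarith

/-- Here L = log r, and D L^(τ-1) will bound the number n of zeros. The first inequality bounds the
base of the n-th power by L^τ; the second absorbs the resulting exponent n τ log L, and the 1
contributed by the zero-free factor, into L^τ'. -/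
lemma eventually_zero_count_bound {τ τ' K D : ℝ} (hτ : 1 < τ) (hτ' : τ - 1 < τ') :
    ∀ᶠ L : ℝ in atTop, 1 + 4 * (K + 2) * (D * L ^ (τ - 1) + 1) ≤ L ^ τ ∧
      D * L ^ (τ - 1) * (τ * Real.log L) + 1 ≤ L ^ τ' := by
  have hconst : ∀ (u v : ℝ), 0 < v → (fun _ : ℝ => u) =o[atTop] (fun L : ℝ => L ^ v) :=
    fun u v hv => isLittleO_const_left.2 (Or.inr
      (tendsto_norm_atTop_atTop.comp (tendsto_rpow_atTop hv)))
  have h1 : (fun L : ℝ => 4 * (K + 2) * D * L ^ (τ - 1) + (1 + 4 * (K + 2))) =o[atTop]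
      (fun L : ℝ => L ^ τ) := by
    refine IsLittleO.add (IsLittleO.const_mul_left ?_ _) (hconst _ _ (by linarith))
    refine (((hconst 1 1 one_pos).mul_isBigO
      (isBigO_refl (fun L : ℝ => L ^ (τ - 1)) atTop)).congr_left fun L => one_mul _)
      |>.trans_eventuallyEq ?_
    filter_upwards [eventually_gt_atTop 0] with L hL
    rw [← Real.rpow_add hL, add_sub_cancel]
  have h2 : (fun L : ℝ => D * τ * (Real.log L * L ^ (τ - 1)) + 1) =o[atTop]
      (fun L : ℝ => L ^ τ') := by
    refine IsLittleO.add (IsLittleO.const_mul_left ?_ _) (hconst _ _ (by linarith))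
    refine ((isLittleO_log_rpow_atTop (sub_pos.2 hτ')).mul_isBigO
      (isBigO_refl (fun L : ℝ => L ^ (τ - 1)) atTop)).trans_eventuallyEq ?_
    filter_upwards [eventually_gt_atTop 0] with L hL
    rw [← Real.rpow_add hL, sub_add_cancel]
  filter_upwards [h1.bound one_pos, h2.bound one_pos, eventually_gt_atTop 0] with L e1 e2 hL
  rw [one_mul, Real.norm_eq_abs, Real.norm_eq_abs, abs_of_nonneg (Real.rpow_nonneg hL.le _)]
    at e1 e2
  have e1' := (le_abs_self _).trans e1
  have e2' := (le_abs_self _).trans e2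
  constructor <;> linarith

set_option maxHeartbeats 1000000 in
/-- For an entire function of finite logarithmic order, on suitable circles of arbitrarily large
radius its values dominate the values on a disk of comparable radius up to a factor of smaller
growth. -/
theorem LogGrowth.exists_circle {f : ℂ → ℂ} (hf : Differentiable ℂ f) (hf0 : f ≠ 0) {τ τ' : ℝ}
    (hτ : 1 < τ) (hτ' : τ - 1 < τ') (hg : LogGrowth f τ) (K : ℝ) :
    ∀ᶠ r : ℝ in atTop, ∃ t, r ≤ t ∧ t ≤ 2 * r ∧ ∀ y, ‖y‖ = t → f y ≠ 0 ∧
      ∀ x, ‖x‖ ≤ K * r → ‖f x‖ ≤ Real.exp (Real.log r ^ τ') * ‖f y‖ := by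
  wlog hK : 2 ≤ K generalizing K
  · filter_upwards [this 2 le_rfl, eventually_gt_atTop 0] with r hr hr0
    obtain ⟨t, h1, h2, h3⟩ := hr
    refine ⟨t, h1, h2, fun y hy => ⟨(h3 y hy).1, fun x hx => (h3 y hy).2 x ?_⟩⟩
    push Not at hK
    nlinarith
  obtain ⟨x₀, hx₀, hfx₀⟩ := exists_ne_zero_norm_le_one hf hf0
  set c : ℝ := |Real.log ‖f x₀‖| with hc
  -- Zeros in |x| ≤ r² are counted with the circle of radius r⁴, whose logarithm is 4L. This gives
  -- nL ≤ (4L)^τ + c, and c ≤ L^τ eventually.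
  set D : ℝ := 4 ^ τ + 1 with hD
  have hlog := Real.tendsto_log_atTop
  have hsq : Tendsto (fun r : ℝ => (r ^ 2) ^ 2) atTop atTop :=
    (tendsto_pow_atTop two_ne_zero).comp (tendsto_pow_atTop two_ne_zero)
  filter_upwards [hsq.eventually hg, eventually_ge_atTop (4 * K + 2),
    hlog.eventually (eventually_mul_rpow_add_le_exp (16 * K * 5) (c + 1) τ (b := 4) (by norm_num)),
    hlog.eventually (eventually_zero_count_bound (K := K) (D := D) hτ hτ'),
    hlog.eventually ((tendsto_rpow_atTop (by linarith : 0 < τ)).eventually_ge_atTop c),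
    hlog.eventually (eventually_gt_atTop 0)]
    with r hgr hrK hexp hcount hcL hL
  have hr0 : 0 < r := by linarith
  set L := Real.log r with hLdef
  rw [Real.exp_log hr0] at hexp
  have hR3 : 3 ≤ r ^ 2 := by nlinarith
  obtain ⟨S, h, hS, hh, hfh, hzf⟩ := exists_rootProd_mul hf hx₀ hfx₀ hR3
  obtain ⟨t, ht1, ht2, hgap⟩ := exists_radius_gap S hr0
  set n := S.card with hn
  have hlogR : Real.log ((r ^ 2) ^ 2) = 4 * L := by
    rw [Real.log_pow, Real.log_pow]; push_cast; ring
  rw [hlogR] at hgr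
  have hnL : n * L ≤ (4 * L) ^ τ + c := by
    have h1 := card_roots_bound hh hS hfh hR3 hx₀ fun x hx => hgr x hx.le
    have h2 : r ^ n * ‖f x₀‖ ≤ Real.exp ((4 * L) ^ τ) := by
      refine le_trans ?_ h1
      gcongr
      nlinarith
    have h3 := Real.log_le_log (by positivity) h2
    rw [Real.log_exp, Real.log_mul (by positivity) (by simpa), Real.log_pow] at h3
    have := neg_abs_le (Real.log ‖f x₀‖)
    linarith
  -- log ‖h x‖ ≤ (4L)^τ and log ‖h x₀‖ ≥ -c - 3nL, so the difference is at most 4((4L)^τ + c). The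
  -- constant 5 and the added 1 are slack, which also makes M positive.
  set M : ℝ := 5 * ((4 * L) ^ τ + (c + 1)) with hMdef
  have hcnn : 0 ≤ c := abs_nonneg _
  have hrp : 0 ≤ (4 * L) ^ τ := by positivity
  have hMpos : 0 < M := by positivity
  have hhx₀ : Real.log ‖f x₀‖ ≤ n * (3 * L) + Real.log ‖h x₀‖ := by
    have h1 : ‖rootProd S x₀‖ ≤ (r ^ 3) ^ n :=
      norm_rootProd_le (by positivity) fun a ha => by
        have := norm_sub_le x₀ a
        have := hS a ha
        nlinarith
    have h2 : ‖f x₀‖ ≤ (r ^ 3) ^ n * ‖h x₀‖ := by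
      rw [hfh, norm_mul]; gcongr
    have h3 := Real.log_le_log (by simpa) h2
    rw [Real.log_mul (by positivity) (by simpa using hzf x₀ (by linarith)), Real.log_pow,
      Real.log_pow] at h3
    simpa using h3
  have hb : ∀ x, ‖x‖ ≤ r ^ 2 → Real.log ‖h x‖ - Real.log ‖h x₀‖ ≤ M := by
    intro x hx
    have h1 := norm_cofactor_le hh hS hfh (by positivity) (by nlinarith : r ^ 2 < (r ^ 2) ^ 2)
      (fun x hx => hgr x hx.le) (hx.trans (by nlinarith))
    have h2 : ‖h x‖ ≤ Real.exp ((4 * L) ^ τ) := by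
      refine le_trans (le_mul_of_one_le_right (norm_nonneg _) (one_le_pow₀ (by nlinarith))) h1
    have h3 := (Real.log_le_iff_le_exp (by simpa using hzf x hx)).2 h2
    have := neg_abs_le (Real.log ‖f x₀‖)
    nlinarith
  have hKR : K * r + 2 < r ^ 2 := by nlinarith
  refine ⟨t, ht1, ht2, fun y hy => ?_⟩
  have main := fun x (hx : ‖x‖ ≤ K * r) => norm_le_mul_on_circle hh hfh hx₀ hzf hMpos hb hr0 hK
    hKR ht2 hgap hx hy
  refine ⟨(main 0 (by simp; positivity)).1, fun x hx => (main x hx).2.trans ?_⟩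
  gcongr
  have hn_le : (n : ℝ) ≤ D * L ^ (τ - 1) := by
    have : (n : ℝ) * L ≤ D * L ^ (τ - 1) * L := by
      rw [mul_assoc, ← Real.rpow_add_one hL.ne', sub_add_cancel]
      rw [Real.mul_rpow (by norm_num) hL.le] at hnL
      linarith
    exact le_of_mul_le_mul_right this hL
  have h1 : (1 + 4 * (K + 2) * ((n : ℝ) + 1)) ^ n ≤
      Real.exp (D * L ^ (τ - 1) * (τ * Real.log L)) := by
    have e1 : 1 + 4 * (K + 2) * ((n : ℝ) + 1) ≤ L ^ τ := by
      refine le_trans ?_ hcount.1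
      gcongr
    have e2 : Real.log (1 + 4 * (K + 2) * ((n : ℝ) + 1)) ≤ τ * Real.log L := by
      rw [← Real.log_rpow hL]
      exact Real.log_le_log (by positivity) e1
    rw [← Real.log_le_iff_le_exp (by positivity), Real.log_pow]
    have : 0 ≤ Real.log (1 + 4 * (K + 2) * ((n : ℝ) + 1)) :=
      Real.log_nonneg (le_add_of_nonneg_right (by positivity))
    exact mul_le_mul hn_le e2 this ((Nat.cast_nonneg n).trans hn_le)
  -- M is of the order of a power of log r, while the zero-free radius r² exceeds Kr by a factor
  -- r/K.
  have h2 : 4 * M * (K * r + 1) / (r ^ 2 - 2 - K * r) ≤ 1 := by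
    rw [div_le_one (by linarith)]
    have e1 : 16 * K * M ≤ r := by rw [hMdef]; linarith
    have e2 : 4 * M * (K * r + 1) ≤ 16 * K * M * r / 2 := by
      have : K * r + 1 ≤ 2 * (K * r) := by nlinarith
      have := mul_le_mul_of_nonneg_left this (by positivity : 0 ≤ 4 * M)
      linarith
    have e3 : 16 * K * M * r ≤ r * r := by gcongr
    nlinarith
  calc (1 + 4 * (K + 2) * ((n : ℝ) + 1)) ^ n * _
      ≤ Real.exp (D * L ^ (τ - 1) * (τ * Real.log L)) * Real.exp 1 :=
        mul_le_mul h1 (Real.exp_le_exp.2 h2) (Real.exp_pos _).le (Real.exp_pos _).le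
    _ ≤ Real.exp (L ^ τ') := by
      rw [← Real.exp_add]
      exact Real.exp_le_exp.2 hcount.2

/-! ### Nevanlinna characteristic and maximum modulus -/

/-- For a and x in the disk of radius R the right side is nonnegative, and it vanishes for ‖x‖ = R:
this is what makes the reflected factor a majorant with equality on the circle. -/
lemma norm_mul_sub_sq (R : ℝ) (x a : ℂ) :
    ‖(R : ℂ) ^ 2 - (starRingEnd ℂ) a * x‖ ^ 2 - R ^ 2 * ‖x - a‖ ^ 2 =
      (R ^ 2 - ‖a‖ ^ 2) * (R ^ 2 - ‖x‖ ^ 2) := by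
  simp only [Complex.sq_norm, Complex.normSq_apply, ← Complex.ofReal_pow, Complex.sub_re,
    Complex.sub_im, Complex.mul_re, Complex.mul_im, Complex.conj_re, Complex.conj_im,
    Complex.ofReal_re, Complex.ofReal_im]
  ring

/-- Reflecting the zeros in a disk at its boundary circle. -/
lemma exists_zero_free_majorant {R : ℝ} (hR : 0 < R) {S : Multiset ℂ} {h : ℂ → ℂ}
    (hS : ∀ a ∈ S, ‖a‖ < R) (hh : Differentiable ℂ h) (hzf : ∀ x, ‖x‖ ≤ R → h x ≠ 0) :
    ∃ H : ℂ → ℂ, Differentiable ℂ H ∧ (∀ x, ‖x‖ ≤ R → H x ≠ 0) ∧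
      (∀ x, ‖x‖ = R → ‖H x‖ = ‖rootProd S x * h x‖) ∧
      ∀ x, ‖x‖ ≤ R → ‖rootProd S x * h x‖ ≤ ‖H x‖ := by
  induction S using Multiset.induction generalizing h with
  | empty => exact ⟨h, hh, hzf, by simp [rootProd], by simp [rootProd]⟩
  | cons a S ih =>
    have ha : ‖a‖ < R := hS a (by simp)
    have hRc : (R : ℂ) ≠ 0 := by exact_mod_cast hR.ne'
    obtain ⟨H, h1, h2, h3, h4⟩ :=
      -- The factor x - a is traded for (R² - āx)/R, which has no zero in the closed disk, and is
      -- moved into the cofactor.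
      ih (h := fun x => ((R : ℂ) ^ 2 - (starRingEnd ℂ) a * x) / R * h x)
        (fun b hb => hS b (by simp [hb])) (by fun_prop) (fun x hx => by
          refine mul_ne_zero (div_ne_zero (sub_ne_zero.2 fun h0 => ?_) hRc) (hzf x hx)
          have h5 := congrArg norm h0
          rw [norm_pow, norm_mul, Complex.norm_real, Real.norm_eq_abs, abs_of_pos hR,
            RCLike.norm_conj] at h5
          nlinarith [norm_nonneg a, norm_nonneg x])
    have hfac : ∀ x : ℂ, ‖((R : ℂ) ^ 2 - (starRingEnd ℂ) a * x) / R‖ ^ 2 =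
        ‖x - a‖ ^ 2 + (R ^ 2 - ‖a‖ ^ 2) * (R ^ 2 - ‖x‖ ^ 2) / R ^ 2 := fun x => by
      rw [norm_div, div_pow, Complex.norm_real, Real.norm_eq_abs, sq_abs, ← norm_mul_sub_sq]
      field_simp
      ring
    refine ⟨H, h1, h2, fun x hx => ?_, fun x hx => le_trans ?_ (h4 x hx)⟩
    · have h5 := hfac x
      rw [hx, sub_self, mul_zero, zero_div, add_zero,
        sq_eq_sq₀ (norm_nonneg _) (norm_nonneg _)] at h5
      rw [h3 x hx, rootProd_cons, norm_mul, norm_mul, norm_mul, norm_mul, h5]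
      ring
    · have h5 : ‖x - a‖ ≤ ‖((R : ℂ) ^ 2 - (starRingEnd ℂ) a * x) / R‖ := by
        rw [← sq_le_sq₀ (norm_nonneg _) (norm_nonneg _), hfac]
        have : 0 ≤ (R ^ 2 - ‖a‖ ^ 2) * (R ^ 2 - ‖x‖ ^ 2) / R ^ 2 := by
          have e1 : ‖a‖ ^ 2 ≤ R ^ 2 := by gcongr
          have e2 : ‖x‖ ^ 2 ≤ R ^ 2 := by gcongr
          exact div_nonneg (mul_nonneg (sub_nonneg.2 e1) (sub_nonneg.2 e2)) (by positivity)
        linarith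
      rw [rootProd_cons, norm_mul, norm_mul, norm_mul, norm_mul]
      calc ‖x - a‖ * ‖rootProd S x‖ * ‖h x‖ = ‖x - a‖ * (‖rootProd S x‖ * ‖h x‖) := by ring
        _ ≤ ‖((R : ℂ) ^ 2 - (starRingEnd ℂ) a * x) / R‖ * (‖rootProd S x‖ * ‖h x‖) := by gcongr
        _ = _ := by ring

lemma characteristic_top_eq {f : ℂ → ℂ} (hf : Differentiable ℂ f) (r : ℝ) :
    ValueDistribution.characteristic f ⊤ r =
      Real.circleAverage (fun x => Real.posLog ‖f x‖) 0 r := by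
  have h1 : (MeromorphicOn.divisor f univ)⁻ = 0 := by
    rw [negPart_eq_zero]
    exact MeromorphicOn.AnalyticOnNhd.divisor_nonneg fun x _ => hf.analyticAt x
  rw [ValueDistribution.characteristic, Pi.add_apply, ValueDistribution.logCounting_top, h1,
    ValueDistribution.proximity_top]
  simp

/-- The Poisson-Jensen inequality on circles without zeros. -/
lemma norm_le_exp_characteristic {f : ℂ → ℂ} (hf : Differentiable ℂ f) {x₀ : ℂ}
    (hx₀ : ‖x₀‖ ≤ 1) (hfx₀ : f x₀ ≠ 0) {R : ℝ} (hR : 3 ≤ R) (hne : ∀ x, ‖x‖ = R → f x ≠ 0)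
    {w : ℂ} (hw : ‖w‖ ≤ R / 2) :
    ‖f w‖ ≤ Real.exp (3 * ValueDistribution.characteristic f ⊤ R) := by
  have hR0 : 0 < R := by linarith
  obtain ⟨S, h, hS, hh, hfh, hzf⟩ := exists_rootProd_mul hf hx₀ hfx₀ hR
  obtain ⟨H, hH, hH0, hHs, hHb⟩ := exists_zero_free_majorant hR0 (S := S) (fun a ha =>
    lt_of_le_of_ne (hS a ha) fun h0 => hne a h0 (by
      rw [hfh, rootProd_eq_zero_iff.2 ha, zero_mul])) hh hzf
  simp only [← hfh] at hHs hHb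
  have hharm : InnerProductSpace.HarmonicOnNhd (fun u => Real.log ‖H u‖) (closedBall 0 R) :=
    fun u hu => (hH.analyticAt u).harmonicAt_log_norm (hH0 u (by simpa using hu))
  have hwb : w ∈ ball (0 : ℂ) R := by
    rw [mem_ball_zero_iff]; linarith
  have hP := hharm.circleAverage_poissonKernel_smul hwb
  -- The kernel is at most (R + ‖w‖)/(R - ‖w‖), hence at most 3 for ‖w‖ ≤ R/2.
  have hker : ∀ x : ℂ, ‖x‖ = R → 0 ≤ poissonKernel 0 w x ∧ poissonKernel 0 w x ≤ 3 := by
    intro x hx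
    have h1 : R - ‖w‖ ≤ ‖x - w‖ := by rw [← hx]; exact norm_sub_norm_le x w
    have h2 : 0 < R - ‖w‖ := by linarith
    rw [poissonKernel]
    simp only [sub_zero, hx]
    have h3 : 0 < ‖x - w‖ ^ 2 := by
      have := h2.trans_le h1
      positivity
    have hw0 := norm_nonneg w
    refine ⟨div_nonneg (by nlinarith) h3.le, ?_⟩
    rw [div_le_iff₀ h3]
    have : (R - ‖w‖) ^ 2 ≤ ‖x - w‖ ^ 2 := by gcongr
    nlinarith
  have hcont1 : ContinuousOn (poissonKernel 0 w • fun u => Real.log ‖H u‖) (sphere 0 |R|) := by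
    rw [abs_of_pos hR0]
    refine ContinuousOn.smul ?_ ?_
    · unfold poissonKernel
      refine ContinuousOn.div (by fun_prop) (by fun_prop) fun x hx h0 => ?_
      have hx' : ‖x‖ = R := by simpa using hx
      simp only [sub_zero] at h0
      have h4 : x = w := by simpa [sub_eq_zero] using h0
      rw [h4] at hx'
      linarith
    · refine ContinuousOn.log (hH.continuous.norm.continuousOn) fun x hx => ?_
      have hx' : ‖x‖ = R := by simpa using hx
      simpa using hH0 x hx'.le
  have hcont2 : Continuous fun x => Real.posLog ‖f x‖ := by
    have := hf.continuous
    fun_prop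
  have hmono : Real.circleAverage (poissonKernel 0 w • fun u => Real.log ‖H u‖) 0 R ≤
      Real.circleAverage (fun x => (3 : ℝ) • Real.posLog ‖f x‖) 0 R := by
    refine Real.circleAverage_mono hcont1.circleIntegrable'
      (hcont2.const_smul (3 : ℝ)).continuousOn.circleIntegrable' fun x hx => ?_
    have hx' : ‖x‖ = R := by simpa [abs_of_pos hR0] using hx
    simp only [Pi.smul_apply', smul_eq_mul, hHs x hx']
    obtain ⟨k0, k3⟩ := hker x hx'
    have hl : Real.log ‖f x‖ ≤ Real.posLog ‖f x‖ := le_max_right _ _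
    have hl0 : 0 ≤ Real.posLog ‖f x‖ := Real.posLog_nonneg
    exact (mul_le_mul_of_nonneg_left hl k0).trans (mul_le_mul_of_nonneg_right k3 hl0)
  rw [hP, Real.circleAverage_fun_smul, smul_eq_mul, ← characteristic_top_eq hf] at hmono
  refine (hHb w (by linarith)).trans ?_
  exact (Real.log_le_iff_le_exp (by simpa using hH0 w (by linarith))).1 hmono

/-- Supplies the zero-free circles that the Poisson-Jensen estimate requires. -/
lemma exists_radius_no_zeros {f : ℂ → ℂ} (hf : Differentiable ℂ f) {x₀ : ℂ}
    (hx₀ : ‖x₀‖ ≤ 1) (hfx₀ : f x₀ ≠ 0) {r : ℝ} (hr : 3 ≤ r) :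
    ∃ t, r ≤ t ∧ t ≤ 2 * r ∧ ∀ x, ‖x‖ = t → f x ≠ 0 := by
  obtain ⟨S, h, hS, hh, hfh, hzf⟩ := exists_rootProd_mul hf hx₀ hfx₀ (R := 2 * r) (by linarith)
  obtain ⟨t, h1, h2, h3⟩ := exists_radius_gap S (by linarith : 0 < r)
  refine ⟨t, h1, h2, fun x hx => ?_⟩
  rw [hfh]
  refine mul_ne_zero (fun h0 => ?_) (hzf x (by linarith))
  have := h3 x (rootProd_eq_zero_iff.1 h0)
  rw [hx, sub_self, abs_zero] at this
  have : 0 < r / (4 * ((S.card : ℝ) + 1)) := by positivity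
  linarith

/-- Constant factors and dilations of r are absorbed by any increase of the exponent. -/
lemma eventually_mul_log_rpow_le {a b σ τ : ℝ} (ha : 0 ≤ a) (hb : 0 < b) (hσ : 0 < σ)
    (hστ : σ < τ) : ∀ᶠ r : ℝ in atTop, a * (Real.log (b * r) ^ σ + 1) ≤ Real.log r ^ τ := by
  have h0 := hσ.trans hστ
  have hconst : ∀ (u v : ℝ), 0 < v → (fun _ : ℝ => u) =o[atTop] (fun L : ℝ => L ^ v) :=
    fun u v hv => isLittleO_const_left.2 (Or.inr
      (tendsto_norm_atTop_atTop.comp (tendsto_rpow_atTop hv)))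
  have h1 : (fun L : ℝ => a * 2 ^ σ * L ^ σ + a) =o[atTop] (fun L : ℝ => L ^ τ) := by
    refine IsLittleO.add (IsLittleO.const_mul_left ?_ _) (hconst _ _ h0)
    refine (((hconst 1 (τ - σ) (by linarith)).mul_isBigO
      (isBigO_refl (fun L : ℝ => L ^ σ) atTop)).congr_left fun L => one_mul _)
      |>.trans_eventuallyEq ?_
    filter_upwards [eventually_gt_atTop 0] with L hL
    rw [← Real.rpow_add hL, sub_add_cancel]
  filter_upwards [Real.tendsto_log_atTop.eventually (h1.bound one_pos), eventually_ge_atTop b,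
    eventually_gt_atTop 1, eventually_ge_atTop b⁻¹] with r hr hbr hr1 hbr'
  have hL : 0 ≤ Real.log r := Real.log_nonneg hr1.le
  rw [one_mul, Real.norm_eq_abs, Real.norm_eq_abs, abs_of_nonneg (Real.rpow_nonneg hL _)] at hr
  refine le_trans ?_ ((le_abs_self _).trans hr)
  have h2 : Real.log (b * r) ≤ 2 * Real.log r := by
    rw [Real.log_mul hb.ne' (by linarith), two_mul]
    gcongr
  have h3 : 0 ≤ Real.log (b * r) := Real.log_nonneg (by rwa [inv_le_iff_one_le_mul₀' hb] at hbr')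
  calc a * (Real.log (b * r) ^ σ + 1) ≤ a * ((2 * Real.log r) ^ σ + 1) := by gcongr
    _ = _ := by rw [Real.mul_rpow (by norm_num) hL]; ring

lemma characteristic_lt_of_logOrder_lt {f : ℂ → ℂ} {τ : ℝ} (h : logOrder f < τ) :
    ∀ᶠ r : ℝ in atTop, ValueDistribution.characteristic f ⊤ r ≤ Real.log r ^ τ := by
  have h1 := eventually_lt_of_limsup_lt h
  filter_upwards [h1, Real.tendsto_log_atTop.eventually (eventually_gt_atTop 1)] with r hr hL
  have hLL : 0 < Real.log (Real.log r) := Real.log_pos hL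
  rcases le_or_gt (ValueDistribution.characteristic f ⊤ r) 0 with h0 | h0
  · exact h0.trans (by positivity)
  · rw [EReal.div_lt_iff (by exact_mod_cast hLL) (EReal.coe_ne_top _),
      ENNReal.log_ofReal_of_pos h0, ← EReal.coe_mul, EReal.coe_lt_coe_iff,
      Real.log_lt_iff_lt_exp h0] at hr
    rw [Real.rpow_def_of_pos (by linarith), mul_comm]
    exact hr.le

/-- Functions of small logarithmic order grow slowly. -/
theorem logGrowth_of_logOrder_lt {f : ℂ → ℂ} (hf : Differentiable ℂ f) {τ : ℝ} (hτ : 0 < τ)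
    (h : logOrder f < τ) : LogGrowth f τ := by
  by_cases hf0 : f = 0
  · simp [LogGrowth, hf0, Real.exp_nonneg]
  -- σ is kept positive so that (log t)^σ increases with t.
  obtain ⟨σ, hσ1, hσ2⟩ := EReal.lt_iff_exists_real_btwn.1 (max_lt h (EReal.coe_pos.2 hτ))
  have hσ0 : 0 < σ := EReal.coe_pos.1 ((le_max_right _ _).trans_lt hσ1)
  have hστ : σ < τ := EReal.coe_lt_coe_iff.1 hσ2
  obtain ⟨x₀, hx₀, hfx₀⟩ := exists_ne_zero_norm_le_one hf hf0
  obtain ⟨r₀, hr₀⟩ := eventually_atTop.1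
    (characteristic_lt_of_logOrder_lt ((le_max_left _ _).trans_lt hσ1))
  filter_upwards [eventually_mul_log_rpow_le (a := 3) (b := 4) (by norm_num) (by norm_num) hσ0 hστ, eventually_ge_atTop r₀,
    eventually_ge_atTop 3] with r h1 h2 h3 x hx
  -- A radius in [2r, 4r] puts the disk of radius r within half the radius, at the cost of log 4r
  -- for log r.
  obtain ⟨t, ht1, ht2, hne⟩ := exists_radius_no_zeros hf hx₀ hfx₀ (r := 2 * r) (by linarith)
  refine (norm_le_exp_characteristic hf hx₀ hfx₀ (by linarith) hne (by linarith)).trans ?_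
  refine Real.exp_le_exp.2 (le_trans ?_ h1)
  have h4 := hr₀ t (by linarith)
  have h5 : Real.log t ^ σ ≤ Real.log (4 * r) ^ σ := by
    have : Real.log t ≤ Real.log (4 * r) := Real.log_le_log (by linarith) (by linarith)
    exact Real.rpow_le_rpow (Real.log_nonneg (by linarith)) this hσ0.le
  linarith

/-- Slow growth bounds the logarithmic order. -/
theorem logOrder_le_of_logGrowth {f : ℂ → ℂ} (hf : Differentiable ℂ f) {τ : ℝ}
    (h : LogGrowth f τ) : logOrder f ≤ τ := by
  refine limsup_le_of_le (by isBoundedDefault) ?_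
  filter_upwards [h, eventually_gt_atTop 1,
    Real.tendsto_log_atTop.eventually (eventually_gt_atTop 1)] with r hr hr1 hL
  have hLL : 0 < Real.log (Real.log r) := Real.log_pos hL
  rw [EReal.div_le_iff_le_mul (by exact_mod_cast hLL) (EReal.coe_ne_top _)]
  have hT : ValueDistribution.characteristic f ⊤ r ≤ Real.log r ^ τ := by
    rw [characteristic_top_eq hf]
    have hcont : Continuous fun x => Real.posLog ‖f x‖ := by
      have := hf.continuous
      fun_prop
    refine Real.circleAverage_mono_on_of_le_circle hcont.continuousOn.circleIntegrable'
      fun x hx => ?_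
    have hx' : ‖x‖ = r := by simpa [abs_of_pos (show 0 < r by linarith)] using hx
    refine max_le (by positivity) ?_
    rcases eq_or_ne (f x) 0 with h0 | h0
    · simp [h0]; positivity
    · exact (Real.log_le_iff_le_exp (by simpa)).2 (hr x hx'.le)
  rcases le_or_gt (ValueDistribution.characteristic f ⊤ r) 0 with h0 | h0
  · simp [h0]
  · rw [ENNReal.log_ofReal_of_pos h0, ← EReal.coe_mul, EReal.coe_le_coe_iff,
      Real.log_le_iff_le_exp h0, ← Real.rpow_def_of_pos (by linarith)]
    exact hT

/-- Settles the degenerate first-order case A₀ = 0, because `⊥ + 1 = ⊥`. -/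
lemma logOrder_zero : logOrder (0 : ℂ → ℂ) = ⊥ := by
  refine le_bot_iff.1 (limsup_le_of_le (by isBoundedDefault) ?_)
  filter_upwards [Real.tendsto_log_atTop.eventually (eventually_gt_atTop 1)] with r hL
  have hLL : 0 < Real.log (Real.log r) := Real.log_pos hL
  rw [EReal.div_le_iff_le_mul (by exact_mod_cast hLL) (EReal.coe_ne_top _),
    characteristic_top_eq (f := 0) (differentiable_const 0)]
  simp [Real.circleAverage_const]

/-! ### The substitution x = (z + 1/z)/2 -/

lemma breve_eq (f : ℂ → ℂ) (z : ℂ) : breve f z = f (breve id z) := rfl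

/-- Every point is of the form `(z + 1/z)/2` with `1 ≤ ‖z‖`. -/
lemma exists_breve_id_eq (x : ℂ) :
    ∃ z : ℂ, breve id z = x ∧ 1 ≤ ‖z‖ := by
  obtain ⟨w, hw⟩ := IsAlgClosed.exists_pow_nat_eq (x ^ 2 - 1) (n := 2) two_pos
  have h1 : (x + w) * (x - w) = 1 := by linear_combination -hw
  have h2 : (x + w)⁻¹ = x - w := inv_eq_of_mul_eq_one_right h1
  have h3 : (x - w)⁻¹ = x + w := inv_eq_of_mul_eq_one_left h1
  rcases le_total 1 ‖x + w‖ with h | h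
  · exact ⟨x + w, by simp only [breve, h2, id]; ring, h⟩
  · refine ⟨x - w, by simp only [breve, h3, id]; ring, ?_⟩
    rw [← h2, norm_inv]
    refine (one_le_inv₀ (norm_pos_iff.2 fun h0 => ?_)).2 h
    simp [h0] at h1

lemma norm_breve_id_le {z : ℂ} (hz : 1 ≤ ‖z‖) : ‖breve id z‖ ≤ ‖z‖ := by
  have h1 : ‖z⁻¹‖ ≤ 1 := by rw [norm_inv]; exact inv_le_one_of_one_le₀ hz
  have h2 := norm_add_le z z⁻¹
  simp only [breve, id, norm_div, Complex.norm_ofNat]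
  linarith

lemma norm_le_of_breve_id {z : ℂ} (hz : 1 ≤ ‖z‖) : ‖z‖ ≤ 2 * ‖breve id z‖ + 1 := by
  have h1 : ‖z⁻¹‖ ≤ 1 := by rw [norm_inv]; exact inv_le_one_of_one_le₀ hz
  have h2 := norm_le_norm_add_norm_sub' z (-z⁻¹)
  rw [norm_neg, sub_neg_eq_add] at h2
  simp only [breve, id, norm_div, Complex.norm_ofNat]
  linarith

lemma continuousAt_breve {f : ℂ → ℂ} (hf : Continuous f) {z : ℂ} (hz : z ≠ 0) :
    ContinuousAt (breve f) z := by
  unfold breve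
  exact hf.continuousAt.comp (by fun_prop (disch := assumption))

lemma EqMero.eventually {g h : ℂ → ℂ} (H : EqMero g h) {z : ℂ} (hz : z ≠ 0) :
    ∀ᶠ w in 𝓝[≠] z, g w = h w := by
  have h1 := mem_codiscreteWithin_iff_forall_mem_nhdsNE.1 H z hz
  filter_upwards [h1, (eventually_ne_nhds hz).filter_mono nhdsWithin_le_nhds] with w hw hw0
  simpa [hw0] using hw

/-! ### Bounds for the Askey-Wilson operator -/

section Operator

variable {s : ℂ}

lemma breve_id_sub (s w : ℂ) :
    breve id (s * w) - breve id (s⁻¹ * w) = (s - s⁻¹) * (w - w⁻¹) / 2 := by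
  simp only [breve, id, mul_inv, inv_inv]
  ring

/-- The denominator is (s - s⁻¹)(w - w⁻¹)/2, of size comparable to ‖w‖. The gain 1/‖w‖ is kept for
the first-order equation. -/
lemma norm_awD_le (hs1 : s - s⁻¹ ≠ 0) {g : ℂ → ℂ} {w : ℂ} {M : ℝ} (hw : 2 ≤ ‖w‖)
    (h1 : ‖g (s * w)‖ ≤ M) (h2 : ‖g (s⁻¹ * w)‖ ≤ M) :
    ‖awD s g w‖ ≤ 2 * M / (‖s - s⁻¹‖ / 4 * ‖w‖) := by
  have h3 : ‖w‖ / 2 ≤ ‖w - w⁻¹‖ := by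
    have h4 : ‖w⁻¹‖ ≤ 1 := by rw [norm_inv]; exact inv_le_one_of_one_le₀ (by linarith)
    have := norm_sub_norm_le w w⁻¹
    linarith
  have h5 : 0 < ‖s - s⁻¹‖ := norm_pos_iff.2 hs1
  have hM : 0 ≤ M := (norm_nonneg _).trans h1
  rw [awD, norm_div, breve_id_sub, norm_div, norm_mul, Complex.norm_ofNat]
  have h6 := norm_sub_le (g (s * w)) (g (s⁻¹ * w))
  have h7 : ‖s - s⁻¹‖ / 4 * ‖w‖ ≤ ‖s - s⁻¹‖ * ‖w - w⁻¹‖ / 2 := by nlinarith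
  exact div_le_div₀ (by positivity) (by linarith) (by positivity) h7

/-- The j-fold iterate samples g only in the annulus ‖s‖^j ‖w‖ ≤ ‖y‖ ≤ ‖s‖^(-j) ‖w‖. This lies
beyond ρ, where the lower bound for the denominators is at least 1, so each application costs at
most a factor 2. -/
lemma norm_awD_iterate_le (hs : s ≠ 0) (hs1 : s - s⁻¹ ≠ 0) (hlt : ‖s‖ < 1) {ρ : ℝ}
    (hρ2 : 2 ≤ ρ) (hρ : 1 ≤ ‖s - s⁻¹‖ / 4 * ρ) {M : ℝ} (j : ℕ) {g : ℂ → ℂ} {w : ℂ}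
    (hw : ρ ≤ ‖s‖ ^ j * ‖w‖)
    (hg : ∀ y, ‖s‖ ^ j * ‖w‖ ≤ ‖y‖ → ‖s‖ ^ j * ‖y‖ ≤ ‖w‖ → ‖g y‖ ≤ M) :
    ‖(awD s)^[j] g w‖ ≤ 2 ^ j * M := by
  have hs0 : 0 < ‖s‖ := norm_pos_iff.2 hs
  have hinv : ∀ y : ℂ, ‖s⁻¹ * y‖ = ‖s‖⁻¹ * ‖y‖ := fun y => by rw [norm_mul, norm_inv]
  induction j generalizing g M with
  | zero =>
    simp only [pow_zero, one_mul, Function.iterate_zero, id] at *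
    exact hg w le_rfl le_rfl
  | succ j ih =>
    have hsj : ‖s‖ ^ j * ‖w‖ ≥ ‖s‖ ^ (j + 1) * ‖w‖ := by
      gcongr ?_ * _
      exact pow_le_pow_of_le_one hs0.le hlt.le (Nat.le_succ j)
    rw [Function.iterate_succ_apply, pow_succ, mul_assoc]
    refine ih (hw.trans hsj) fun y hy1 hy2 => ?_
    have hyρ : ρ ≤ ‖y‖ := (hw.trans hsj).trans hy1
    have hM1 : ‖g (s * y)‖ ≤ M := by
      refine hg _ ?_ ?_
      · rw [norm_mul, pow_succ']
        nlinarith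
      · rw [norm_mul]
        refine le_trans ?_ hy2
        rw [pow_succ]
        have h1 : ‖s‖ * (‖s‖ * ‖y‖) ≤ ‖y‖ := by
          have := norm_nonneg y
          nlinarith [mul_le_mul_of_nonneg_right hlt.le (by positivity : 0 ≤ ‖s‖ * ‖y‖)]
        have := mul_le_mul_of_nonneg_left h1 (by positivity : 0 ≤ ‖s‖ ^ j)
        linarith
    have hM2 : ‖g (s⁻¹ * y)‖ ≤ M := by
      refine hg _ ?_ ?_
      · rw [hinv]
        refine (hsj.trans hy1).trans (le_mul_of_one_le_left (norm_nonneg _) ?_)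
        exact (one_le_inv₀ hs0).2 hlt.le
      · rw [hinv, pow_succ, mul_assoc, mul_inv_cancel_left₀ hs0.ne']
        exact hy2
    have hM0 : 0 ≤ M := (norm_nonneg _).trans hM1
    refine (norm_awD_le hs1 (hρ2.trans hyρ) hM1 hM2).trans ?_
    refine div_le_self (by positivity) (hρ.trans ?_)
    gcongr

end Operator

/-! ### The weights -/

section Weights

variable {q s : ℂ}

lemma qPochInf_eq_mul (hq1 : ‖q‖ < 1) (a : ℂ) :
    qPochInf a q = (1 - a) * qPochInf (a * q) q := by
  have hsum : ∀ a : ℂ, Summable fun k : ℕ => ‖-(a * q ^ k)‖ := fun a => by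
    simp only [norm_neg, norm_mul, norm_pow]
    exact (summable_geometric_of_lt_one (norm_nonneg q) hq1).mul_left _
  have h1 : Multipliable fun k : ℕ => 1 - a * q ^ (k + 1) := by
    have := multipliable_one_add_of_summable (hsum (a * q))
    refine this.congr fun k => ?_
    ring
  have h2 := tprod_eq_zero_mul' (f := fun k : ℕ => 1 - a * q ^ k) h1
  simp only [pow_zero, mul_one] at h2
  rw [qPochInf, h2, qPochInf]
  congr 2
  ext k
  ring

/-- Near z₀ the function φ is bounded, so all but finitely many factors 1 - φ(z)qⁿ are nonzero, and
each remaining one vanishes on a finite fibre. Only fibres over c ≠ 0 matter, which admits φ = 0,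
that is, a zero parameter of the weight. -/
lemma eventually_qPochInf_ne_zero (hq0 : q ≠ 0) (hq1 : ‖q‖ < 1) {φ : ℂ → ℂ} {z₀ : ℂ}
    (hφ : ContinuousAt φ z₀) (hfin : ∀ c, c ≠ 0 → {z | φ z = c}.Finite) :
    ∀ᶠ z in 𝓝[≠] z₀, qPochInf (φ z) q ≠ 0 := by
  set B := ‖φ z₀‖ + 1 with hB
  have hb : ∀ᶠ z in 𝓝[≠] z₀, ‖φ z‖ < B :=
    (hφ.norm.eventually_lt continuousAt_const (by simp [hB])).filter_mono nhdsWithin_le_nhds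
  obtain ⟨N, hN⟩ : ∃ N : ℕ, ∀ n ≥ N, ‖q‖ ^ n * B < 1 := by
    have := (tendsto_pow_atTop_nhds_zero_of_lt_one (norm_nonneg q) hq1).mul_const B
    rw [zero_mul] at this
    exact eventually_atTop.1 (this.eventually (gt_mem_nhds one_pos))
  have hn : ∀ᶠ z in 𝓝[≠] z₀, ∀ n ∈ Finset.range N, φ z ≠ (q ^ n)⁻¹ :=
    (eventually_all_finset _).2 fun n _ =>
      nhdsNE_le_cofinite z₀ (hfin _ (inv_ne_zero (pow_ne_zero _ hq0))).compl_mem_cofinite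
  filter_upwards [hb, hn] with z hz1 hz2
  have := tprod_one_add_ne_zero_of_summable (f := fun k : ℕ => -(φ z * q ^ k)) (fun n h0 => ?_) ?_
  · simpa only [qPochInf, sub_eq_add_neg] using this
  · have h1 : φ z * q ^ n = 1 := by linear_combination -h0
    rcases lt_or_ge n N with h | h
    · exact hz2 n (Finset.mem_range.2 h) (eq_inv_of_mul_eq_one_left h1)
    · have h2 := congrArg norm h1
      rw [norm_mul, norm_pow, norm_one] at h2
      have := hN n h
      have : ‖φ z‖ * ‖q‖ ^ n ≤ B * ‖q‖ ^ n := by gcongr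
      linarith
  · simp only [norm_neg, norm_mul, norm_pow]
    exact (summable_geometric_of_lt_one (norm_nonneg q) hq1).mul_left _

lemma finite_setOf_sq_eq (c : ℂ) : {z : ℂ | z ^ 2 = c}.Finite := by
  obtain ⟨w, rfl⟩ := IsAlgClosed.exists_pow_nat_eq c (n := 2) two_pos
  refine (Set.toFinite {w, -w}).subset fun z hz => ?_
  simpa using sq_eq_sq_iff_eq_or_eq_neg.1 hz

lemma eventually_qPair_ne_zero (hq0 : q ≠ 0) (hq1 : ‖q‖ < 1) (a : ℂ) {z₀ : ℂ} (hz₀ : z₀ ≠ 0) :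
    ∀ᶠ z in 𝓝[≠] z₀, qPair q a z ≠ 0 := by
  have h1 := eventually_qPochInf_ne_zero hq0 hq1 (φ := fun z => a * z) (z₀ := z₀) (by fun_prop)
    fun c hc => (Set.finite_singleton (c / a)).subset fun z (hz : a * z = c) => by
      have ha : a ≠ 0 := by rintro rfl; simp at hz; exact hc hz.symm
      rw [mem_singleton_iff, eq_div_iff ha, mul_comm, hz]
  have h2 := eventually_qPochInf_ne_zero hq0 hq1 (φ := fun z => a * z⁻¹) (z₀ := z₀)
    (by fun_prop (disch := assumption))
    fun c hc => (Set.finite_singleton (a / c)).subset fun z (hz : a * z⁻¹ = c) => by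
      have hz0 : z ≠ 0 := by rintro rfl; simp at hz; exact hc hz.symm
      rw [mem_singleton_iff, eq_div_iff hc, ← hz]
      field_simp
  filter_upwards [h1, h2] with z e1 e2
  exact mul_ne_zero e1 e2

lemma eventually_qPochInf_sq_ne_zero (hq0 : q ≠ 0) (hq1 : ‖q‖ < 1) {z₀ : ℂ} (hz₀ : z₀ ≠ 0) :
    ∀ᶠ z in 𝓝[≠] z₀, qPochInf (z ^ 2) q ≠ 0 ∧ qPochInf ((z ^ 2)⁻¹) q ≠ 0 := by
  have hz2 : z₀ ^ 2 ≠ 0 := pow_ne_zero 2 hz₀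
  refine (eventually_qPochInf_ne_zero hq0 hq1 (by fun_prop) fun c _ => finite_setOf_sq_eq c).and
    (eventually_qPochInf_ne_zero hq0 hq1 (by fun_prop (disch := assumption)) fun c _ => ?_)
  refine (finite_setOf_sq_eq c⁻¹).subset fun z (hz : (z ^ 2)⁻¹ = c) => ?_
  rw [mem_ofPred_eq, ← hz, inv_inv]

lemma qPair_inv (a z : ℂ) : qPair q a z⁻¹ = qPair q a z := by
  rw [qPair, qPair, inv_inv, mul_comm]

/-- Only sin θ changes sign under z ↦ 1/z. This reduces the shift by s⁻¹ to the shift by s. -/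
lemma awWeight_inv (a b c d z : ℂ) : awWeight q a b c d z⁻¹ = -awWeight q a b c d z := by
  simp only [awWeight, qPair_inv, inv_pow, inv_inv]
  rw [← neg_sub z, neg_div, mul_neg, div_neg, mul_comm (qPochInf ((z ^ 2)⁻¹) q)]

/-- Moving to (as, sz) multiplies az by q and fixes a/z, so exactly one factor is lost. -/
lemma qPair_eq_mul_shift (hs : s ^ 2 = q) (hs0 : s ≠ 0) (hq1 : ‖q‖ < 1) (a z : ℂ) :
    qPair q a z = (1 - a * z) * qPair q (a * s) (s * z) := by
  have h1 : a * s * (s * z) = a * z * q := by rw [← hs]; ring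
  have h2 : a * s * (s * z)⁻¹ = a * z⁻¹ := by
    rw [mul_inv]; field_simp
  rw [qPair, qPair, h1, h2, qPochInf_eq_mul hq1 (a * z)]
  ring

/-- Nonvanishing of all the factors of the Askey-Wilson weight. -/
def WeightFactorsNeZero (q a b c d z : ℂ) : Prop :=
  (qPair q a z ≠ 0 ∧ qPair q b z ≠ 0 ∧ qPair q c z ≠ 0 ∧ qPair q d z ≠ 0) ∧
    qPochInf (z ^ 2) q ≠ 0 ∧ qPochInf ((z ^ 2)⁻¹) q ≠ 0

lemma WeightFactorsNeZero.inv {a b c d z : ℂ} (h : WeightFactorsNeZero q a b c d z) :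
    WeightFactorsNeZero q a b c d z⁻¹ := by
  simpa only [WeightFactorsNeZero, qPair_inv, inv_pow, inv_inv,
    and_comm (a := qPochInf ((z ^ 2)⁻¹) q ≠ 0)] using h

/-- All infinite products cancel in the quotient of the shifted weight by the original one, leaving
a rational function of order |z|² at infinity. -/
lemma awWeight_shift (hs : s ^ 2 = q) (hs0 : s ≠ 0) (hq1 : ‖q‖ < 1) {a b c d z : ℂ} (hz : z ≠ 0)
    (h : WeightFactorsNeZero q a b c d z) (hqz : (s * z) ^ 2 ≠ 1) :
    awWeight q (a * s) (b * s) (c * s) (d * s) (s * z) = -awWeight q a b c d z *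
      ((1 - a * z) * (1 - b * z) * (1 - c * z) * (1 - d * z) / (s * z ^ 2)) := by
  obtain ⟨⟨ha, hb, hc, hd⟩, h1, h2⟩ := h
  have e1 := qPochInf_eq_mul hq1 (z ^ 2)
  have e2 := qPochInf_eq_mul hq1 (((s * z) ^ 2)⁻¹)
  have e3 : z ^ 2 * q = (s * z) ^ 2 := by rw [← hs]; ring
  have e4 : ((s * z) ^ 2)⁻¹ * q = (z ^ 2)⁻¹ := by rw [← hs]; field_simp
  rw [e3] at e1
  rw [e4] at e2
  rw [awWeight, awWeight, e1, e2]
  rw [qPair_eq_mul_shift hs hs0 hq1 a z, qPair_eq_mul_shift hs hs0 hq1 b z,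
    qPair_eq_mul_shift hs hs0 hq1 c z, qPair_eq_mul_shift hs hs0 hq1 d z]
  rw [qPair_eq_mul_shift hs hs0 hq1] at ha hb hc hd
  rw [e1] at h1
  -- The infinite products become opaque, so that only a rational identity remains.
  generalize qPochInf ((s * z) ^ 2) q = u at *
  generalize qPochInf ((z ^ 2)⁻¹) q = v at *
  generalize qPair q (a * s) (s * z) = pa at *
  generalize qPair q (b * s) (s * z) = pb at *
  generalize qPair q (c * s) (s * z) = pc at *
  generalize qPair q (d * s) (s * z) = pd at *
  have a1 := left_ne_zero_of_mul ha
  have a2 := right_ne_zero_of_mul ha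
  have b1 := left_ne_zero_of_mul hb
  have b2 := right_ne_zero_of_mul hb
  have c1 := left_ne_zero_of_mul hc
  have c2 := right_ne_zero_of_mul hc
  have d1 := left_ne_zero_of_mul hd
  have d2 := right_ne_zero_of_mul hd
  have z1 := left_ne_zero_of_mul h1
  have hI := Complex.I_ne_zero
  have n1 : s * z - (s * z)⁻¹ = ((s * z) ^ 2 - 1) / (s * z) := by field_simp
  have n2 : z - z⁻¹ = -(1 - z ^ 2) / z := by field_simp; ring
  have n3 : 1 - ((s * z) ^ 2)⁻¹ = ((s * z) ^ 2 - 1) / (s * z) ^ 2 := by field_simp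
  have n4 : (s * z) ^ 2 - 1 ≠ 0 := sub_ne_zero.2 hqz
  rw [n1, n2, n3]
  generalize (s * z) ^ 2 - 1 = m at *
  generalize 1 - z ^ 2 = m' at *
  generalize 1 - a * z = A at *
  generalize 1 - b * z = B at *
  generalize 1 - c * z = C at *
  generalize 1 - d * z = D at *
  field_simp

lemma awWeight_shift_inv (hs : s ^ 2 = q) (hs0 : s ≠ 0) (hq1 : ‖q‖ < 1) {a b c d z : ℂ}
    (hz : z ≠ 0) (h : WeightFactorsNeZero q a b c d z) (hqz : (s * z⁻¹) ^ 2 ≠ 1) :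
    awWeight q (a * s) (b * s) (c * s) (d * s) (s⁻¹ * z) = -awWeight q a b c d z *
      ((1 - a * z⁻¹) * (1 - b * z⁻¹) * (1 - c * z⁻¹) * (1 - d * z⁻¹) * z ^ 2 / s) := by
  have h1 := awWeight_shift hs hs0 hq1 (inv_ne_zero hz) h.inv hqz
  have h2 : s⁻¹ * z = (s * z⁻¹)⁻¹ := by rw [mul_inv, inv_inv]
  rw [h2, awWeight_inv, h1, awWeight_inv]
  field_simp

lemma WeightFactorsNeZero.awWeight_ne_zero (hq1 : ‖q‖ < 1) {a b c d z : ℂ} (hz : z ≠ 0)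
    (h : WeightFactorsNeZero q a b c d z) : awWeight q a b c d z ≠ 0 := by
  obtain ⟨⟨ha, hb, hc, hd⟩, h1, h2⟩ := h
  have h3 : z - z⁻¹ ≠ 0 := fun h0 => by
    rw [qPochInf_eq_mul hq1] at h1
    refine left_ne_zero_of_mul h1 ?_
    have := congrArg (· * z) h0
    simp only [sub_mul, inv_mul_cancel₀ hz, zero_mul] at this
    linear_combination -this
  exact div_ne_zero (mul_ne_zero h1 h2) (mul_ne_zero (mul_ne_zero (mul_ne_zero (mul_ne_zero ha hb)
    hc) hd) (div_ne_zero h3 (mul_ne_zero two_ne_zero Complex.I_ne_zero)))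

end Weights

/-! ### Control of the coefficients by the solution -/

/-- The range allowed for w covers every z within a factor 2 of z₀ in modulus and its shifts s^(±1)
z. At most k further shifts keep the modulus between ‖s‖^(k+1) ‖z₀‖/2 and 2‖z₀‖/‖s‖^(k+1), which
dictates ρ and K. -/
lemma exists_region_bound {s : ℂ} (hs : s ≠ 0) (hs1 : s - s⁻¹ ≠ 0) (hlt : ‖s‖ < 1) (k : ℕ) :
    ∃ ρ K : ℝ, 0 < ρ ∧ 0 ≤ K ∧ ∀ z₀ w : ℂ, ρ ≤ ‖z₀‖ → ‖s‖ * (‖z₀‖ / 2) ≤ ‖w‖ →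
      ‖s‖ * ‖w‖ ≤ 2 * ‖z₀‖ → 2 ≤ ‖w‖ ∧ 1 ≤ ‖s - s⁻¹‖ / 4 * ‖w‖ ∧
      ∀ (f : ℂ → ℂ) (W : ℝ), (∀ y, ‖y‖ ≤ K * ‖z₀‖ → ‖f y‖ ≤ W) →
        ∀ j ≤ k, ‖(awD s)^[j] (breve f) w‖ ≤ 2 ^ k * W := by
  have hs0 : 0 < ‖s‖ := norm_pos_iff.2 hs
  have hκ : 0 < ‖s - s⁻¹‖ / 4 := by have := norm_pos_iff.2 hs1; positivity
  set κ := ‖s - s⁻¹‖ / 4 with hκdef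
  set ρ₀ := max 2 κ⁻¹ with hρ₀
  have h2 : 2 ≤ ρ₀ := le_max_left _ _
  have hκρ : 1 ≤ κ * ρ₀ := by
    rw [← mul_inv_cancel₀ hκ.ne']
    gcongr
    exact le_max_right _ _
  have hpow : 0 < ‖s‖ ^ (k + 1) := by positivity
  refine ⟨2 * ρ₀ / ‖s‖ ^ (k + 1), 2 / ‖s‖ ^ (k + 1), by positivity, by positivity,
    fun z₀ w hz₀ hw1 hw2 => ?_⟩
  rw [div_le_iff₀ hpow] at hz₀
  have hmono : ∀ j ≤ k, ‖s‖ ^ k ≤ ‖s‖ ^ j := fun j hj => pow_le_pow_of_le_one hs0.le hlt.le hj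
  have hwk : ∀ j ≤ k, ρ₀ ≤ ‖s‖ ^ j * ‖w‖ := fun j hj => by
    calc ρ₀ ≤ ‖s‖ ^ k * (‖s‖ * (‖z₀‖ / 2)) := by rw [pow_succ] at hz₀; linarith
      _ ≤ ‖s‖ ^ j * ‖w‖ := mul_le_mul (hmono j hj) hw1 (by positivity) (by positivity)
  have hρw : ρ₀ ≤ ‖w‖ := by simpa using hwk 0 (Nat.zero_le k)
  refine ⟨h2.trans hρw, hκρ.trans (by gcongr), fun f W hf j hj => ?_⟩
  have hW : 0 ≤ W := (norm_nonneg (f 0)).trans (hf 0 (by simp; positivity))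
  calc ‖(awD s)^[j] (breve f) w‖ ≤ 2 ^ j * W := by
        refine norm_awD_iterate_le hs hs1 hlt h2 hκρ j (hwk j hj) fun y hy1 hy2 => ?_
        have hy : 1 ≤ ‖y‖ := by linarith [hwk j hj]
        refine hf _ ((norm_breve_id_le hy).trans ?_)
        rw [div_mul_eq_mul_div, le_div_iff₀ hpow]
        calc ‖y‖ * ‖s‖ ^ (k + 1) = ‖s‖ * (‖s‖ ^ k * ‖y‖) := by rw [pow_succ]; ring
          _ ≤ ‖s‖ * (‖s‖ ^ j * ‖y‖) := mul_le_mul_of_nonneg_left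
              (mul_le_mul_of_nonneg_right (hmono j hj) (norm_nonneg _)) hs0.le
          _ ≤ ‖s‖ * ‖w‖ := by gcongr
          _ ≤ 2 * ‖z₀‖ := hw2
    _ ≤ 2 ^ k * W := by gcongr; norm_num

/-- `A` is controlled by `g` and the growth of `f` relative to the values of `f`. -/
def ControlledBy (A f : ℂ → ℂ) (g : ℂ → ℝ) : Prop :=
  ∃ ρ K : ℝ, 0 ≤ K ∧ ∀ z₀ : ℂ, ρ ≤ ‖z₀‖ → ∀ W, (∀ y, ‖y‖ ≤ K * ‖z₀‖ → ‖f y‖ ≤ W) →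
    ‖breve A z₀‖ * ‖breve f z₀‖ ≤ g z₀ * W

lemma eventually_norm_bounds {z₀ : ℂ} (hz₀ : z₀ ≠ 0) :
    ∀ᶠ z in 𝓝[≠] z₀, z ≠ 0 ∧ ‖z₀‖ / 2 ≤ ‖z‖ ∧ ‖z‖ ≤ 2 * ‖z₀‖ := by
  have h0 : 0 < ‖z₀‖ := norm_pos_iff.2 hz₀
  have hc : Tendsto (fun z : ℂ => ‖z‖) (𝓝[≠] z₀) (𝓝 ‖z₀‖) :=
    continuous_norm.continuousAt.tendsto.mono_left nhdsWithin_le_nhds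
  filter_upwards [hc.eventually (lt_mem_nhds (by linarith : ‖z₀‖ / 2 < ‖z₀‖)),
    hc.eventually (gt_mem_nhds (by linarith : ‖z₀‖ < 2 * ‖z₀‖))] with z h1 h2
  exact ⟨norm_pos_iff.1 (by linarith), h1.le, h2.le⟩

/-- The equation may fail on a discrete set, but both sides of the estimate are continuous at z₀, so
it extends there. The good circles then need not avoid exceptional points. -/
lemma controlled_of_eventually {A f : ℂ → ℂ} (hA : Differentiable ℂ A) (hf : Differentiable ℂ f)
    {g : ℂ → ℝ} {z₀ : ℂ} (hz₀ : z₀ ≠ 0) (hg : ContinuousAt g z₀) {W : ℝ}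
    (h : ∀ᶠ z in 𝓝[≠] z₀, ‖breve A z‖ * ‖breve f z‖ ≤ g z * W) :
    ‖breve A z₀‖ * ‖breve f z₀‖ ≤ g z₀ * W :=
  le_of_tendsto_of_tendsto
    (((continuousAt_breve hA.continuous hz₀).norm.mul
      (continuousAt_breve hf.continuous hz₀).norm).tendsto.mono_left nhdsWithin_le_nhds)
    ((hg.mul continuousAt_const).tendsto.mono_left nhdsWithin_le_nhds) h

lemma norm_one_sub_mul_le (a : ℂ) {z : ℂ} {B : ℝ} (hB : 1 ≤ B) (hz : ‖z‖ ≤ B) :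
    ‖1 - a * z‖ ≤ (1 + ‖a‖) * B := by
  refine (norm_sub_le _ _).trans ?_
  rw [norm_one, norm_mul]
  nlinarith [norm_nonneg a, mul_le_mul_of_nonneg_left hz (norm_nonneg a)]

lemma norm_four_factors_le (a b c d : ℂ) {z : ℂ} {B : ℝ} (hB : 1 ≤ B) (hz : ‖z‖ ≤ B) :
    ‖(1 - a * z) * (1 - b * z) * (1 - c * z) * (1 - d * z)‖ ≤
      (1 + ‖a‖) * (1 + ‖b‖) * (1 + ‖c‖) * (1 + ‖d‖) * B ^ 4 := by
  rw [norm_mul, norm_mul, norm_mul]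
  calc _ ≤ ((1 + ‖a‖) * B) * ((1 + ‖b‖) * B) * ((1 + ‖c‖) * B) * ((1 + ‖d‖) * B) := by
        gcongr <;> exact norm_one_sub_mul_le _ hB hz
    _ = _ := by ring

lemma awD_mul_const (s : ℂ) (g : ℂ → ℂ) (c z : ℂ) :
    awD s (fun w => c * g w) z = c * awD s g z := by
  simp only [awD, ← mul_sub, mul_div_assoc]

/-- The coefficient in the second order equation is controlled by the solution. -/
lemma SolvesAW.controlledBy {q s a b c d : ℂ} (hs : s ^ 2 = q) (hq0 : q ≠ 0) (hq1 : ‖q‖ < 1)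
    (hs0 : s ≠ 0) (hs1 : s - s⁻¹ ≠ 0) (hlt : ‖s‖ < 1) {A f : ℂ → ℂ} (hA : Differentiable ℂ A)
    (hf : Differentiable ℂ f) (h : SolvesAW q s a b c d A f) :
    ∃ C : ℝ, 0 ≤ C ∧ ControlledBy A f fun z => C * ‖z‖ ^ 2 := by
  obtain ⟨ρ, K, hρ, hK, hreg⟩ := exists_region_bound hs0 hs1 hlt 1
  have hsn : 0 < ‖s‖ := norm_pos_iff.2 hs0
  set P := (1 + ‖a‖) * (1 + ‖b‖) * (1 + ‖c‖) * (1 + ‖d‖) with hP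
  have hP0 : 0 ≤ P := by positivity
  -- One 2 comes from the two terms of the outer difference quotient, the other from the bound 2W
  -- for the inner one.
  refine ⟨4 * P / ‖s‖, by positivity, ρ, K, hK, fun z₀ hz₀ W hW => ?_⟩
  have hz₀0 : z₀ ≠ 0 := norm_pos_iff.1 (hρ.trans_le hz₀)
  refine controlled_of_eventually hA hf (g := fun z => 4 * P / ‖s‖ * ‖z‖ ^ 2) hz₀0 (by fun_prop) ?_
  filter_upwards [h.eventually hz₀0, eventually_norm_bounds hz₀0,
    eventually_qPair_ne_zero hq0 hq1 a hz₀0, eventually_qPair_ne_zero hq0 hq1 b hz₀0,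
    eventually_qPair_ne_zero hq0 hq1 c hz₀0, eventually_qPair_ne_zero hq0 hq1 d hz₀0,
    eventually_qPochInf_sq_ne_zero hq0 hq1 hz₀0] with z heq hz ha hb hc hd hz2
  obtain ⟨hz0, hz1, hz3⟩ := hz
  have hfac : WeightFactorsNeZero q a b c d z := ⟨⟨ha, hb, hc, hd⟩, hz2⟩
  have hzn := norm_nonneg z
  obtain ⟨r1, r2, -⟩ := hreg z₀ z hz₀ (by nlinarith) (by nlinarith)
  obtain ⟨u1, -, u3⟩ := hreg z₀ (s * z) hz₀ (by rw [norm_mul]; gcongr)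
    (by rw [norm_mul]; nlinarith [mul_le_mul_of_nonneg_right hlt.le hzn,
      mul_le_mul_of_nonneg_right hlt.le (by positivity : 0 ≤ ‖s‖ * ‖z‖)])
  have hinv : ‖s⁻¹ * z‖ = ‖s‖⁻¹ * ‖z‖ := by rw [norm_mul, norm_inv]
  have hinv1 : 1 ≤ ‖s‖⁻¹ := (one_le_inv₀ hsn).2 hlt.le
  obtain ⟨-, -, v3⟩ := hreg z₀ (s⁻¹ * z) hz₀
    (by rw [hinv]
        have := mul_le_mul_of_nonneg_right hinv1 hzn
        nlinarith [norm_nonneg z₀])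
    (by rw [hinv, mul_inv_cancel_left₀ hsn.ne']; exact hz3)
  have hD1 := u3 f W hW 1 le_rfl
  have hD2 := v3 f W hW 1 le_rfl
  simp only [Function.iterate_one, pow_one] at hD1 hD2
  have hqz : (s * z) ^ 2 ≠ 1 := fun h0 => by
    have := congrArg norm h0
    rw [norm_pow, norm_one] at this
    nlinarith
  have hqz' : (s * z⁻¹) ^ 2 ≠ 1 := fun h0 => by
    have := congrArg norm h0
    rw [norm_pow, norm_one, norm_mul, norm_inv] at this
    have h4 : ‖z‖⁻¹ ≤ 1 := inv_le_one_of_one_le₀ (by linarith)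
    have h5 : ‖s‖ * ‖z‖⁻¹ < 1 := by nlinarith [inv_nonneg.2 hzn]
    have h6 : 0 ≤ ‖s‖ * ‖z‖⁻¹ := by positivity
    nlinarith
  set ω := awWeight q a b c d z with hω
  have hω0 : ω ≠ 0 := hfac.awWeight_ne_zero hq1 hz0
  -- As z is fixed, ω is a constant and may be divided out inside the operator, which exposes the
  -- ratios ω̃(s^(±1) z)/ω(z).
  set G : ℂ → ℂ := fun w => ω⁻¹ * (awWeight q (a * s) (b * s) (c * s) (d * s) w *
    awD s (breve f) w) with hG
  have hAf : breve A z * breve f z = -awD s G z := by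
    rw [hG, awD_mul_const]
    refine mul_left_cancel₀ hω0 ?_
    rw [mul_neg, mul_inv_cancel_left₀ hω0]
    linear_combination heq
  have hz2pos : 0 < ‖z‖ ^ 2 := by positivity
  have hG1 : ‖G (s * z)‖ ≤ P * ‖z‖ ^ 2 / ‖s‖ * (2 * W) := by
    have e1 : G (s * z) = -((1 - a * z) * (1 - b * z) * (1 - c * z) * (1 - d * z) /
        (s * z ^ 2) * awD s (breve f) (s * z)) := by
      rw [hG]
      simp only
      rw [awWeight_shift hs hs0 hq1 hz0 hfac hqz, ← hω]
      field_simp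
    rw [e1, norm_neg, norm_mul]
    refine mul_le_mul ?_ hD1 (norm_nonneg _) (by positivity)
    rw [norm_div, norm_mul s, norm_pow]
    calc _ ≤ P * ‖z‖ ^ 4 / (‖s‖ * ‖z‖ ^ 2) := by
          gcongr
          exact norm_four_factors_le a b c d (by linarith) le_rfl
      _ = _ := by field_simp
  have hG2 : ‖G (s⁻¹ * z)‖ ≤ P * ‖z‖ ^ 2 / ‖s‖ * (2 * W) := by
    have e1 : G (s⁻¹ * z) = -((1 - a * z⁻¹) * (1 - b * z⁻¹) * (1 - c * z⁻¹) * (1 - d * z⁻¹) *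
        z ^ 2 / s * awD s (breve f) (s⁻¹ * z)) := by
      rw [hG]
      simp only
      rw [awWeight_shift_inv hs hs0 hq1 hz0 hfac hqz', ← hω]
      field_simp
    rw [e1, norm_neg, norm_mul]
    refine mul_le_mul ?_ hD2 (norm_nonneg _) (by positivity)
    rw [norm_div, norm_mul _ (z ^ 2), norm_pow]
    have h4 : ‖z⁻¹‖ ≤ 1 := by rw [norm_inv]; exact inv_le_one_of_one_le₀ (by linarith)
    have h5 := norm_four_factors_le a b c d le_rfl h4
    rw [one_pow, mul_one] at h5
    gcongr
  have hM0 := (norm_nonneg _).trans hG1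
  rw [← norm_mul, hAf, norm_neg]
  refine (norm_awD_le hs1 r1 hG1 hG2).trans ((div_le_self (by positivity) r2).trans_eq ?_)
  ring

/-- The last coefficient in the linear equation is controlled by the solution and the other
coefficients. -/
lemma SolvesAWOrder.controlledBy {s : ℂ} (hs0 : s ≠ 0) (hs1 : s - s⁻¹ ≠ 0) (hlt : ‖s‖ < 1)
    {k : ℕ} (hk : 1 ≤ k) {A : ℕ → ℂ → ℂ} {f : ℂ → ℂ} (hA : ∀ j < k, Differentiable ℂ (A j))
    (hf : Differentiable ℂ f) (h : SolvesAWOrder s k A f) :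
    ControlledBy (A 0) f fun z => 2 ^ k * (1 + ∑ j ∈ Finset.Ico 1 k, ‖breve (A j) z‖) := by
  obtain ⟨ρ, K, hρ, hK, hreg⟩ := exists_region_bound hs0 hs1 hlt k
  refine ⟨ρ, K, hK, fun z₀ hz₀ W hW => ?_⟩
  have hsn : 0 < ‖s‖ := norm_pos_iff.2 hs0
  have hz₀0 : z₀ ≠ 0 := norm_pos_iff.1 (hρ.trans_le hz₀)
  refine controlled_of_eventually (hA 0 hk) hf
    (g := fun z => 2 ^ k * (1 + ∑ j ∈ Finset.Ico 1 k, ‖breve (A j) z‖)) hz₀0 ?_ ?_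
  · refine continuousAt_const.mul (continuousAt_const.add
      (tendsto_finsetSum _ fun j hj => ?_))
    exact (continuousAt_breve (hA j (Finset.mem_Ico.1 hj).2).continuous hz₀0).norm
  filter_upwards [h.eventually hz₀0, eventually_norm_bounds hz₀0] with z heq hz
  obtain ⟨hz0, hz1, hz3⟩ := hz
  have hzn := norm_nonneg z
  obtain ⟨-, -, r3⟩ := hreg z₀ z hz₀ (by nlinarith) (by nlinarith)
  have hD := r3 f W hW
  rw [Finset.range_eq_Ico, Finset.sum_eq_sum_Ico_succ_bot hk] at heq
  have hAf : breve (A 0) z * breve f z = -((awD s)^[k] (breve f) z +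
      ∑ j ∈ Finset.Ico 1 k, breve (A j) z * (awD s)^[j] (breve f) z) := by
    simp only [Function.iterate_zero, id] at heq
    linear_combination heq
  rw [← norm_mul, hAf, norm_neg]
  calc _ ≤ 2 ^ k * W + ∑ j ∈ Finset.Ico 1 k, ‖breve (A j) z‖ * (2 ^ k * W) := by
        refine (norm_add_le _ _).trans (add_le_add (hD k le_rfl) ?_)
        refine (norm_sum_le _ _).trans (Finset.sum_le_sum fun j hj => ?_)
        rw [norm_mul]
        gcongr
        exact hD j (Finset.mem_Ico.1 hj).2.le
    _ = _ := by rw [← Finset.sum_mul]; ring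

/-- The coefficient in the first order equation is controlled by the solution, with a gain. -/
lemma SolvesAWOrder.controlledBy_one {s : ℂ} (hs0 : s ≠ 0) (hs1 : s - s⁻¹ ≠ 0) (hlt : ‖s‖ < 1)
    {A : ℕ → ℂ → ℂ} {f : ℂ → ℂ} (hA : Differentiable ℂ (A 0)) (hf : Differentiable ℂ f)
    (h : SolvesAWOrder s 1 A f) :
    ControlledBy (A 0) f fun z => 2 / (‖s - s⁻¹‖ / 4 * ‖z‖) := by
  obtain ⟨ρ, K, hρ, hK, hreg⟩ := exists_region_bound hs0 hs1 hlt 0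
  refine ⟨ρ, K, hK, fun z₀ hz₀ W hW => ?_⟩
  have hsn : 0 < ‖s‖ := norm_pos_iff.2 hs0
  have hz₀0 : z₀ ≠ 0 := norm_pos_iff.1 (hρ.trans_le hz₀)
  have hκ : ‖s - s⁻¹‖ / 4 * ‖z₀‖ ≠ 0 := by positivity
  refine controlled_of_eventually hA hf (g := fun z => 2 / (‖s - s⁻¹‖ / 4 * ‖z‖)) hz₀0
    (by fun_prop (disch := assumption)) ?_
  filter_upwards [h.eventually hz₀0, eventually_norm_bounds hz₀0] with z heq hz
  obtain ⟨hz0, hz1, hz3⟩ := hz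
  have hzn := norm_nonneg z
  obtain ⟨r1, -, -⟩ := hreg z₀ z hz₀ (by nlinarith) (by nlinarith)
  obtain ⟨-, -, u3⟩ := hreg z₀ (s * z) hz₀ (by rw [norm_mul]; gcongr)
    (by rw [norm_mul]; nlinarith [mul_le_mul_of_nonneg_right hlt.le hzn,
      mul_le_mul_of_nonneg_right hlt.le (by positivity : 0 ≤ ‖s‖ * ‖z‖)])
  have hinv : ‖s⁻¹ * z‖ = ‖s‖⁻¹ * ‖z‖ := by rw [norm_mul, norm_inv]
  have hinv1 : 1 ≤ ‖s‖⁻¹ := (one_le_inv₀ hsn).2 hlt.le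
  obtain ⟨-, -, v3⟩ := hreg z₀ (s⁻¹ * z) hz₀
    (by rw [hinv]
        have := mul_le_mul_of_nonneg_right hinv1 hzn
        nlinarith [norm_nonneg z₀])
    (by rw [hinv, mul_inv_cancel_left₀ hsn.ne']; exact hz3)
  have hD1 := u3 f W hW 0 le_rfl
  have hD2 := v3 f W hW 0 le_rfl
  simp only [Function.iterate_zero, id, pow_zero, one_mul] at hD1 hD2
  have hAf : breve (A 0) z * breve f z = -awD s (breve f) z := by
    simp at heq
    linear_combination heq
  rw [← norm_mul, hAf, norm_neg]
  exact (norm_awD_le hs1 r1 hD1 hD2).trans_eq (by ring)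

/-! ### Lower bounds for the logarithmic order -/

/-- A function controlled by an entire function of finite logarithmic order is small on suitable
circles. -/
lemma ControlledBy.exists_circle {A f : ℂ → ℂ} {g : ℂ → ℝ} (h : ControlledBy A f g)
    (hf : Differentiable ℂ f) (hf0 : f ≠ 0) {τ τ' : ℝ} (hτ : 1 < τ) (hτ' : τ - 1 < τ')
    (hg : LogGrowth f τ) :
    ∀ᶠ r : ℝ in atTop, ∃ t, r ≤ t ∧ t ≤ 2 * r ∧ ∀ x, ‖x‖ = t → ∃ z, breve id z = x ∧
      r ≤ ‖z‖ ∧ ‖z‖ ≤ 6 * r ∧ ‖A x‖ ≤ g z * Real.exp (Real.log r ^ τ') := by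
  obtain ⟨ρ, K, hK, hρ⟩ := h
  -- For ‖x‖ = t ≤ 2r one has ‖z‖ ≤ 2‖x‖ + 1 ≤ 6r, so the values of f needed at z lie in the disk of
  -- radius 6Kr.
  filter_upwards [hg.exists_circle hf hf0 hτ hτ' (6 * K), eventually_ge_atTop ρ,
    eventually_ge_atTop 1] with r hr hrρ hr1
  obtain ⟨t, ht1, ht2, ht⟩ := hr
  refine ⟨t, ht1, ht2, fun x hx => ?_⟩
  obtain ⟨z, hzx, hz1⟩ := exists_breve_id_eq x
  have h1 : r ≤ ‖z‖ := by
    have := norm_breve_id_le hz1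
    rw [hzx] at this
    linarith
  have h2 : ‖z‖ ≤ 6 * r := by
    have := norm_le_of_breve_id hz1
    rw [hzx] at this
    linarith
  refine ⟨z, hzx, h1, h2, ?_⟩
  obtain ⟨hfx, hb⟩ := ht x hx
  have h3 := hρ z (hrρ.trans h1) (Real.exp (Real.log r ^ τ') * ‖f x‖) fun y hy =>
    hb y (hy.trans (by nlinarith))
  rw [breve_eq A, breve_eq f, hzx, ← mul_assoc] at h3
  exact le_of_mul_le_mul_right h3 (norm_pos_iff.2 hfx)

/-- By the maximum principle, one good circle outside radius r controls the whole disk. -/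
lemma logGrowth_of_circles {A : ℂ → ℂ} (hA : Differentiable ℂ A) {τ : ℝ}
    (h : ∀ᶠ r : ℝ in atTop, ∃ t, r ≤ t ∧ ∀ x, ‖x‖ = t → ‖A x‖ ≤ Real.exp (Real.log r ^ τ)) :
    LogGrowth A τ := by
  filter_upwards [h, eventually_gt_atTop 0] with r ⟨t, h1, h2⟩ hr x hx
  exact norm_le_of_sphere hA (by linarith) h2 (hx.trans h1)

/-- τ bounds the growth of f, σ that of the comparison factor and of the minor coefficients; the
room between σ and σ' absorbs constants and powers of r. All three are real even if α is `⊤`. -/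
lemma exists_exponents {α φ : EReal} (h1 : 1 < α) (hφ : φ < α + 1) (S : Finset ℕ)
    (β : ℕ → EReal) (hβ : ∀ j ∈ S, β j < α) :
    ∃ τ σ σ' : ℝ, 1 < τ ∧ φ < τ ∧ τ - 1 < σ ∧ 1 < σ ∧ σ < σ' ∧ (σ' : EReal) < α ∧
      ∀ j ∈ S, β j < σ := by
  obtain ⟨τ₀, hτ1, hτ2⟩ := EReal.lt_iff_exists_real_btwn.1 hφ
  have hτα : ((τ₀ - 1 : ℝ) : EReal) < α := by
    induction α with
    | bot => simp at h1
    | top => exact EReal.coe_lt_top _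
    | coe a =>
      have : τ₀ < a + 1 := by exact_mod_cast hτ2
      exact_mod_cast (by linarith : τ₀ - 1 < a)
  have hsup : S.sup β < α := (Finset.sup_lt_iff (bot_le.trans_lt h1)).2 hβ
  obtain ⟨σ, hσ1, hσ2⟩ := EReal.lt_iff_exists_real_btwn.1 (max_lt h1 (max_lt hτα hsup))
  obtain ⟨σ', hσ'1, hσ'2⟩ := EReal.lt_iff_exists_real_btwn.1 hσ2
  obtain ⟨h2, h3, h4⟩ : 1 < (σ : EReal) ∧ ((τ₀ - 1 : ℝ) : EReal) < σ ∧ S.sup β < σ := by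
    simpa only [max_lt_iff] using hσ1
  have h2' : 1 < σ := by exact_mod_cast h2
  have h3' : τ₀ - 1 < σ := by exact_mod_cast h3
  refine ⟨max τ₀ (3 / 2), σ, σ', lt_max_of_lt_right (by norm_num),
    hτ1.trans_le (by exact_mod_cast le_max_left _ _), ?_, h2', by exact_mod_cast hσ'1, hσ'2,
    fun j hj => (Finset.le_sup hj).trans_lt h4⟩
  rw [sub_lt_iff_lt_add]
  exact max_lt (by linarith) (by linarith)

lemma eventually_log_le_rpow {σ : ℝ} (hσ : 1 ≤ σ) :
    ∀ᶠ r : ℝ in atTop, Real.log r ≤ Real.log r ^ σ := by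
  filter_upwards [Real.tendsto_log_atTop.eventually (eventually_ge_atTop 1)] with r hr
  exact Real.self_le_rpow_of_one_le hr hσ

lemma mul_exp_le_exp {C E U V : ℝ} (hU : C ≤ Real.exp E) (hV : U + E ≤ V) :
    C * Real.exp U ≤ Real.exp V := by
  calc C * Real.exp U ≤ Real.exp E * Real.exp U := by gcongr
    _ = Real.exp (U + E) := by rw [← Real.exp_add, add_comm]
    _ ≤ _ := Real.exp_le_exp.2 hV

/-- Lower bound for the logarithmic order of the solutions of the second order equation. -/
theorem SolvesAW.logOrder_add_one_le {q s a b c d : ℂ} (hs : s ^ 2 = q) (hq0 : q ≠ 0)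
    (hq1 : ‖q‖ < 1) (hs0 : s ≠ 0) (hs1 : s - s⁻¹ ≠ 0) (hlt : ‖s‖ < 1) {A f : ℂ → ℂ}
    (hA : Differentiable ℂ A) (hA1 : 1 < logOrder A) (hf : Differentiable ℂ f) (hf0 : f ≠ 0)
    (h : SolvesAW q s a b c d A f) : logOrder A + 1 ≤ logOrder f := by
  by_contra! hcon
  obtain ⟨τ, σ, σ', hτ, hfτ, hτσ, hσ, hσσ', hσ'A, -⟩ :=
    exists_exponents hA1 hcon ∅ (fun _ => ⊥) (by simp)
  obtain ⟨C, hC, hctrl⟩ := h.controlledBy hs hq0 hq1 hs0 hs1 hlt hA hf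
  have hgrowth := hctrl.exists_circle hf hf0 hτ hτσ
    (logGrowth_of_logOrder_lt hf (by linarith) hfτ)
  refine absurd hσ'A (not_lt.2 (logOrder_le_of_logGrowth hA (logGrowth_of_circles hA ?_)))
  filter_upwards [hgrowth, eventually_ge_atTop (C * 36), eventually_gt_atTop 0,
    eventually_log_le_rpow hσ.le,
    eventually_mul_log_rpow_le (a := 4) (b := 1) (by norm_num) one_pos (by linarith) hσσ']
    with r ⟨t, ht1, ht2, ht⟩ hrC hr0 hlog hfin
  refine ⟨t, ht1, fun x hx => ?_⟩
  obtain ⟨z, -, -, hz2, hAx⟩ := ht x hx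
  -- C‖z‖² ≤ 36Cr² ≤ r³, and (log r)^σ + 3 log r ≤ 4 (log r)^σ ≤ (log r)^σ'.
  refine hAx.trans (mul_exp_le_exp (E := 3 * Real.log r) ?_ ?_)
  · calc C * ‖z‖ ^ 2 ≤ C * (6 * r) ^ 2 := by gcongr
      _ = C * 36 * r ^ 2 := by ring
      _ ≤ r * r ^ 2 := by gcongr
      _ = Real.exp (3 * Real.log r) := by
        rw [mul_comm 3, Real.exp_mul, Real.exp_log hr0]
        norm_cast
        ring
  · rw [one_mul] at hfin
    linarith

/-- In the first order equation, a solution of logarithmic order less than two forces the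
coefficient to vanish. -/
lemma SolvesAWOrder.eq_zero_of_logOrder_lt_two {s : ℂ} (hs0 : s ≠ 0) (hs1 : s - s⁻¹ ≠ 0)
    (hlt : ‖s‖ < 1) {A : ℕ → ℂ → ℂ} {f : ℂ → ℂ} (hA : Differentiable ℂ (A 0))
    (hf : Differentiable ℂ f) (hf0 : f ≠ 0) (h : SolvesAWOrder s 1 A f)
    (hf2 : logOrder f < (2 : ℝ)) : A 0 = 0 := by
  obtain ⟨τ₀, h1, h2⟩ := EReal.lt_iff_exists_real_btwn.1 hf2
  have h2' : τ₀ < 2 := by exact_mod_cast h2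
  -- With τ < 2 the exponent σ can be taken below 1. Then exp((log r)^σ) ≤ r^(1/2) eventually, which
  -- the gain 1/‖z‖ beats: the bound for A₀ tends to 0 like r^(-1/2).
  obtain ⟨τ, hτ1, hτ2⟩ := exists_between (max_lt h2' (by norm_num : (1 : ℝ) < 2))
  obtain ⟨σ, hσ1, hσ2⟩ := exists_between (by linarith : τ - 1 < 1)
  have hτ : 1 < τ := (le_max_right _ _).trans_lt hτ1
  have hfτ : logOrder f < τ := h1.trans (by exact_mod_cast (le_max_left _ _).trans_lt hτ1)
  have hgrowth := (h.controlledBy_one hs0 hs1 hlt hA hf).exists_circle hf hf0 hτ hσ1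
    (logGrowth_of_logOrder_lt hf (by linarith) hfτ)
  have hκ : 0 < ‖s - s⁻¹‖ / 4 := by have := norm_pos_iff.2 hs1; positivity
  set κ := ‖s - s⁻¹‖ / 4
  funext x₀
  rw [Pi.zero_apply, ← norm_le_zero_iff]
  have hlim : Tendsto (fun r : ℝ => 2 / κ * Real.exp (-(Real.log r / 2))) atTop (𝓝 0) := by
    rw [← mul_zero (2 / κ)]
    refine Tendsto.const_mul _ (Real.tendsto_exp_atBot.comp (tendsto_neg_atTop_atBot.comp ?_))
    exact Real.tendsto_log_atTop.atTop_div_const two_pos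
  refine ge_of_tendsto hlim ?_
  filter_upwards [hgrowth, eventually_gt_atTop 0, eventually_ge_atTop ‖x₀‖,
    eventually_mul_log_rpow_le (a := 2) (b := 1) (by norm_num) one_pos (by linarith) hσ2]
    with r ⟨t, ht1, ht2, ht⟩ hr0 hrx hfin
  refine norm_le_of_sphere hA (by linarith) (fun x hx => ?_) (hrx.trans ht1)
  obtain ⟨z, -, hz1, -, hAx⟩ := ht x hx
  rw [one_mul, Real.rpow_one] at hfin
  calc ‖A 0 x‖ ≤ 2 / (κ * ‖z‖) * Real.exp (Real.log r ^ σ) := hAx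
    _ ≤ 2 / (κ * r) * Real.exp (Real.log r / 2) := by
        gcongr
        linarith
    _ = 2 / κ * (Real.exp (Real.log r / 2) / r) := by field_simp
    _ = 2 / κ * Real.exp (-(Real.log r / 2)) := by
        nth_rw 2 [← Real.exp_log hr0]
        rw [← Real.exp_sub]
        congr 2
        ring

/-- Lower bound for the logarithmic order of the solutions of linear equations with dominant last
coefficient. -/
theorem SolvesAWOrder.logOrder_add_one_le {s : ℂ} (hs0 : s ≠ 0) (hs1 : s - s⁻¹ ≠ 0)
    (hlt : ‖s‖ < 1) {k : ℕ} (hk : 1 ≤ k) {A : ℕ → ℂ → ℂ} {f : ℂ → ℂ}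
    (hA : ∀ j < k, Differentiable ℂ (A j))
    (hdom : ∀ j, 1 ≤ j → j < k → 1 ≤ logOrder (A j) ∧ logOrder (A j) < logOrder (A 0))
    (hf : Differentiable ℂ f) (hf0 : f ≠ 0) (h : SolvesAWOrder s k A f) :
    logOrder (A 0) + 1 ≤ logOrder f := by
  by_contra! hcon
  rcases le_or_gt (logOrder (A 0)) 1 with hA0 | hA0
  · have hk1 : k = 1 := by
      by_contra hne
      have h1 := hdom 1 le_rfl (by omega)
      exact absurd (h1.1.trans_lt h1.2) (not_lt.2 hA0)
    subst hk1
    have hf2 : logOrder f < (2 : ℝ) := by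
      refine hcon.trans_le ((add_le_add_left hA0 1).trans_eq ?_)
      rw [← EReal.coe_one, ← EReal.coe_add]
      norm_num
    have h0 := h.eq_zero_of_logOrder_lt_two hs0 hs1 hlt (hA 0 hk) hf hf0 hf2
    rw [h0, logOrder_zero, EReal.bot_add] at hcon
    exact not_lt_bot hcon
  · obtain ⟨τ, σ, σ', hτ, hfτ, hτσ, hσ, hσσ', hσ'A, hAσ⟩ :=
      exists_exponents hA0 hcon (Finset.Ico 1 k) (fun j => logOrder (A j)) fun j hj =>
        (hdom j (Finset.mem_Ico.1 hj).1 (Finset.mem_Ico.1 hj).2).2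
    have hgrowth := (h.controlledBy hs0 hs1 hlt hk hA hf).exists_circle hf hf0 hτ hτσ
      (logGrowth_of_logOrder_lt hf (by linarith) hfτ)
    have hcoef : ∀ᶠ r : ℝ in atTop, ∀ j ∈ Finset.Ico 1 k, ∀ x, ‖x‖ ≤ r →
        ‖A j x‖ ≤ Real.exp (Real.log r ^ σ) := (eventually_all_finset _).2 fun j hj =>
      logGrowth_of_logOrder_lt (hA j (Finset.mem_Ico.1 hj).2) (by linarith) (hAσ j hj)
    have h2r : Tendsto (fun r : ℝ => 2 * r) atTop atTop := tendsto_id.const_mul_atTop two_pos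
    refine absurd hσ'A (not_lt.2 (logOrder_le_of_logGrowth (hA 0 hk)
      (logGrowth_of_circles (hA 0 hk) ?_)))
    filter_upwards [hgrowth, h2r.eventually hcoef, eventually_ge_atTop (2 ^ k * (1 + k : ℝ)),
      eventually_ge_atTop 1, h2r.eventually (eventually_log_le_rpow hσ.le),
      eventually_mul_log_rpow_le (a := 3) (b := 2) (by norm_num) two_pos (by linarith) hσσ']
      with r ⟨t, ht1, ht2, ht⟩ hcf hrk hr1 hlog hfin
    refine ⟨t, ht1, fun x hx => ?_⟩
    obtain ⟨z, hzx, -, -, hAx⟩ := ht x hx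
    have hlogr : Real.log r ≤ Real.log (2 * r) := Real.log_le_log (by linarith) (by linarith)
    have hlog0 : 0 ≤ Real.log r := Real.log_nonneg hr1
    set E := Real.log (2 * r) ^ σ with hE
    have hE0 : 0 ≤ E := Real.rpow_nonneg (hlog0.trans hlogr) _
    have hLE : Real.log r ^ σ ≤ E := Real.rpow_le_rpow hlog0 hlogr (by linarith)
    -- The coefficient sum contributes exp E, the constant 2^k (1 + k) ≤ r another exp E, and the
    -- comparison factor a third; hence 3E ≤ (log r)^σ'.
    refine hAx.trans (mul_exp_le_exp (E := 2 * E) ?_ (by linarith))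
    have hsum : 1 + ∑ j ∈ Finset.Ico 1 k, ‖breve (A j) z‖ ≤ (1 + k) * Real.exp E := by
      have h1 : ∑ j ∈ Finset.Ico 1 k, ‖breve (A j) z‖ ≤ ∑ j ∈ Finset.Ico 1 k, Real.exp E :=
        Finset.sum_le_sum fun j hj => by
          rw [breve_eq, hzx]
          exact hcf j hj x (by linarith)
      rw [Finset.sum_const, Nat.card_Ico, nsmul_eq_mul] at h1
      have h2 : ((k - 1 : ℕ) : ℝ) ≤ k := by exact_mod_cast Nat.sub_le k 1
      have h3 : 1 ≤ Real.exp E := Real.one_le_exp hE0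
      have h4 : ((k - 1 : ℕ) : ℝ) * Real.exp E ≤ k * Real.exp E := by gcongr
      linarith
    calc 2 ^ k * (1 + ∑ j ∈ Finset.Ico 1 k, ‖breve (A j) z‖)
        ≤ 2 ^ k * ((1 + k) * Real.exp E) := by gcongr
      _ = 2 ^ k * (1 + k : ℝ) * Real.exp E := by ring
      _ ≤ r * Real.exp E := by gcongr
      _ ≤ Real.exp E * Real.exp E := by
        gcongr
        rw [← Real.log_le_iff_le_exp (by linarith)]
        exact hlogr.trans hlog
      _ = Real.exp (2 * E) := by rw [← Real.exp_add, two_mul]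

theorem theoremT (q s : ℂ) (hs : s ^ 2 = q) (hq0 : q ≠ 0) (hq1 : ‖q‖ < 1) :
    (∀ (a b c d : ℂ) (A f : ℂ → ℂ),
      Differentiable ℂ A → 1 < logOrder A → logOrder A < ⊤ →
      Differentiable ℂ f → f ≠ 0 → SolvesAW q s a b c d A f →
      logOrder A + 1 ≤ logOrder f) ∧
    (∀ (k : ℕ) (A : ℕ → ℂ → ℂ) (f : ℂ → ℂ), 1 ≤ k →
      (∀ j < k, Differentiable ℂ (A j)) →
      (∀ j, 1 ≤ j → j < k → 1 ≤ logOrder (A j) ∧ logOrder (A j) < logOrder (A 0)) →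
      Differentiable ℂ f → f ≠ 0 → SolvesAWOrder s k A f →
      logOrder (A 0) + 1 ≤ logOrder f) := by
  have hs0 : s ≠ 0 := by
    rintro rfl
    exact hq0 (by rw [← hs]; simp)
  have hlt : ‖s‖ < 1 := by
    rw [← hs, norm_pow] at hq1
    exact (pow_lt_one_iff_of_nonneg (norm_nonneg s) two_ne_zero).1 hq1
  have hs1 : s - s⁻¹ ≠ 0 := fun h0 => by
    have h1 : s ^ 2 = 1 := by
      rw [pow_two]
      nth_rw 2 [sub_eq_zero.1 h0]
      exact mul_inv_cancel₀ hs0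
    rw [← hs, h1, norm_one] at hq1
    exact lt_irrefl _ hq1
  exact ⟨fun a b c d A f hA hA1 _ hf hf0 h =>
      h.logOrder_add_one_le hs hq0 hq1 hs0 hs1 hlt hA hA1 hf hf0,
    fun k A f hk hA hdom hf hf0 h =>
      h.logOrder_add_one_le hs0 hs1 hlt hk hA hdom hf hf0⟩
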